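/- A quantum finite automaton (QFA) with rational amplitudes $M$ consists of a finite set $Q=\{q_1,\dots,q_n\}$ of states; a finite input alphabet $\Sigma$ not containing the end-marker symbol $\#$; for each symbol $\sigma\in\Sigma\cup\{\#\}$ a finite list $E_{\sigma,1},\dots,E_{\sigma,l_\sigma}\in\mathbb{Q}^{n\times n}$ with $\sum_k E_{\sigma,k}^{\dagger}E_{\sigma,k}=I$, defining the superoperator $\mathcal{E}_\sigma(\rho)=\sum_k E_{\sigma,k}\,\rho\,E_{\sigma,k}^{\dagger}$; an initial basis state $|q_s\rangle$ with $q_s\in Q$; and a projective measurement $\{P_a,P_r\}$, where $P_a,P_r\in\mathbb{Q}^{n\times n}$ are orthogonal projections with $P_a+P_r=I$. On input $w\in\Sigma^*$ the automaton reads the tape $\#w\#$ from left to right, one superoperator per symbol, starting from $|q_s\rangle\langle q_s|$. If $\rho$ is the density operator after the right end-marker has been read, then $f_M(w)=\mathrm{Tr}(P_a\,\rho)$ is the probability that $M$ accepts $w$. As a universal QFA (UQFA; negative one-sided unbounded error), $M$ recognizes the language $L\subseteq\Sigma^*$ if $f_M(w)=1$ for every $w\in L$ and $f_M(w)<1$ for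 every $w\in\Sigma^*\setminus L$. **Corollary.** The emptiness problem for UQFAs with rational amplitudes is undecidable: there is no algorithm that, given (the finite description of) an arbitrary QFA $M$ with rational amplitudes, always halts and correctly decides whether the language recognized by $M$ as a UQFA is empty. -/

import Mathlib

/-- A (realtime) quantum finite automaton with amplitudes in `R`. For `R = ℂ` this is the general
notion; for `R = ℚ` (with trivial star operation) these are the automata with rational amplitudes.
The states are `Fin numStates`, the input alphabet is `Fin numSymbols`, and `none` is the
end-marker. -/
structure QFA (R : Type) [CommRing R] [StarRing R] where
  numStates : ℕ
  numSymbols : ℕ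
  /-- The operation elements of the superoperator of a tape symbol. -/
  ops : Option (Fin numSymbols) → List (Matrix (Fin numStates) (Fin numStates) R)
  ops_complete : ∀ σ, ((ops σ).map fun A => A.conjTranspose * A).sum = 1
  init : Fin numStates
  /-- The projections of the final measurement, for the outcomes "accept" and "reject". -/
  projAcc : Matrix (Fin numStates) (Fin numStates) R
  projRej : Matrix (Fin numStates) (Fin numStates) R
  projAcc_herm : projAcc.IsHermitian
  projAcc_idem : projAcc * projAcc = projAcc
  projRej_herm : projRej.IsHermitian
  projRej_idem : projRej * projRej = projRej
  proj_complete : projAcc + projRej = 1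

namespace QFA

section
variable {R : Type} [CommRing R] [StarRing R]

/-- The superoperator of the tape symbol `σ`, applied to `ρ`. -/
def superop (M : QFA R) (σ : Option (Fin M.numSymbols))
    (ρ : Matrix (Fin M.numStates) (Fin M.numStates) R) :
    Matrix (Fin M.numStates) (Fin M.numStates) R :=
  ((M.ops σ).map fun A => A * ρ * A.conjTranspose).sum

/-- The tape content for the input `w`: an end-marker, then `w`, then an end-marker. -/
def tape {k : ℕ} (w : List (Fin k)) : List (Option (Fin k)) :=
  none :: (w.map some ++ [none])

/-- The density operator after the whole tape has been read, starting from the initial basis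
state. -/
def finalState (M : QFA R) (w : List (Fin M.numSymbols)) :
    Matrix (Fin M.numStates) (Fin M.numStates) R :=
  (tape w).foldl (fun ρ σ => M.superop σ ρ) (Matrix.single M.init M.init 1)

/-- The probability that `M` accepts `w`. -/
def accProb (M : QFA R) (w : List (Fin M.numSymbols)) : R :=
  (M.projAcc * M.finalState w).trace

end

/-- `M`, as a universal QFA (negative one-sided unbounded error), recognizes the language `L`. -/
def UniversalRecognizes (M : QFA ℚ) (L : Language (Fin M.numSymbols)) : Prop :=
  (∀ w, w ∈ L → M.accProb w = 1) ∧ (∀ w, w ∉ L → M.accProb w < 1)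

/-- The rows of a rational matrix, each entry written as (numerator, denominator). -/
def encodeMatrix {n : ℕ} (A : Matrix (Fin n) (Fin n) ℚ) : List (List (ℤ × ℕ)) :=
  List.ofFn fun i => List.ofFn fun j => ((A i j).num, (A i j).den)

/-- Finite data describing a rational QFA: the numbers of states and of input symbols; the lists of
operation elements, the list of the end-marker first and then one list for each input symbol; the
index of the initial state; and the two projections. -/
abbrev Code : Type :=
  ℕ × ℕ × List (List (List (List (ℤ × ℕ)))) × ℕ × List (List (ℤ × ℕ)) × List (List (ℤ × ℕ))

def encode (M : QFA ℚ) : Code :=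
  (M.numStates, M.numSymbols,
    (M.ops none).map encodeMatrix ::
      List.ofFn (fun a : Fin M.numSymbols => (M.ops (some a)).map encodeMatrix),
    (M.init : ℕ), encodeMatrix M.projAcc, encodeMatrix M.projRej)

theorem encodeMatrix_injective {n : ℕ} :
    Function.Injective (encodeMatrix : Matrix (Fin n) (Fin n) ℚ → List (List (ℤ × ℕ))) := by
  intro A B h
  ext i j
  have h1 := congrFun (List.ofFn_injective h) i
  have h2 := congrFun (List.ofFn_injective h1) j
  simp only [Prod.mk.injEq] at h2
  exact Rat.ext h2.1 h2.2

/-- A rational QFA is determined by its code. -/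
theorem encode_injective : Function.Injective encode := by
  rintro ⟨n, k, E, hE, s, Pa, Pr, h1, h2, h3, h4, h5⟩ ⟨n', k', E', hE', s', Pa', Pr', _, _, _, _, _⟩ h
  simp only [encode, Prod.mk.injEq, List.cons.injEq] at h
  obtain ⟨rfl, rfl, ⟨hn, hs⟩, hi, ha, hr⟩ := h
  have e1 : s = s' := Fin.ext hi
  have e2 : Pa = Pa' := encodeMatrix_injective ha
  have e3 : Pr = Pr' := encodeMatrix_injective hr
  have e4 : E = E' := by
    funext σ
    cases σ with
    | none => exact (List.map_injective_iff.2 encodeMatrix_injective) hn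
    | some a =>
      exact (List.map_injective_iff.2 encodeMatrix_injective)
        (congrFun (List.ofFn_injective hs) a)
  subst e1 e2 e3 e4
  rfl

end QFA

/-- The decision problem "given `a : α`, presented by its code `code a`, does `p a` hold?" is
decidable: some algorithm halts on the code of every `a : α` with the right answer. Nothing is
required of the algorithm on inputs that are not codes. -/
def DecidableProblem {α β : Type} [Primcodable β] (code : α → β) (p : α → Prop) : Prop :=
  ∃ f : β →. Bool, Partrec f ∧ ∀ a, ∃ b ∈ f (code a), (b = true ↔ p a)

/-! The halting problem reduces to non-emptiness. Fix a partial recursive `f` with undecidable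
domain. To each `n` an automaton `M n` is attached that accepts some word with probability 1 exactly
when `f n` is defined, and whose code depends computably on `n`. As the empty language is recognized
exactly when no word has acceptance probability 1, a decision procedure for emptiness would decide
the domain of `f`.

The words are computation histories. A program is a regular language of register instructions;
guessing replaces branching, and a wrong guess is caught by an equality check. Product, union and
star of languages act as composition, union and iteration of relations on registers, which suffices
for every partial recursive function (`Instr.exists_computes`). So `f n` is defined iff some word of
one fixed regular language executes with `n` in register 0.

Each instruction is affine in the registers, and each check is the vanishing of a linear form. The
automaton keeps, in one unnormalized pure state, the control state of a DFA for the program, the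
registers, and an amplitude for rejection that receives the value of the check. Its rejection
probability is a sum of squares over all choices of operation elements, hence 0 iff no choice leads
to rejection (`QFA.rejTrace_eq_zero_iff`). Scaling therefore does not matter, and amplitudes never
cancel between choices.

An arbitrary linear map must be completed to a superoperator with rational entries. After rescaling,
the defect of completeness is a sum of rational matrices `u uᵀ` (`exists_complete_ops`). The
additional elements either keep the rejecting amplitude or lead to an accepting basis state, so they
do not disturb the argument. The number `n` enters only through the first end-marker, as a rational
unit vector. -/

namespace Language

/-! ### Closure of regular languages under product and star. -/

open scoped Computability

variable {α : Type*}

/-- The union of a set of languages. -/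
def unionOf (S : Set (Language α)) : Language α := {x | ∃ K ∈ S, x ∈ K}

theorem isRegular_singleton_singleton (a : α) : ({[a]} : Language α).IsRegular := by
  refine .of_finite_range_leftQuotient
    ((Set.toFinite {({[a]} : Language α), ({[]} : Language α), (∅ : Set (List α))}).subset ?_)
  rintro _ ⟨x, rfl⟩
  rcases x with _ | ⟨b, _ | ⟨c, x⟩⟩
  · left; rfl
  · by_cases h : b = a
    · subst h
      right; left
      ext y
      change [b] ++ y = [b] ↔ y = []
      simp
    · right; right
      ext y
      change [b] ++ y = [a] ↔ False
      simp [h]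
  · right; right
    ext y
    change (b :: c :: x) ++ y = [a] ↔ False
    simp

/-- The cut between the two factors falls either after `x` or inside it. This expresses the quotient
by one quotient of `L` and a set of quotients of `M`, so there are only finitely many. -/
theorem leftQuotient_mul (L M : Language α) (x : List α) :
    (L * M).leftQuotient x = L.leftQuotient x * M +
      unionOf {K | ∃ u ∈ L, ∃ v, u ++ v = x ∧ K = M.leftQuotient v} := by
  ext y
  simp only [mem_leftQuotient, mem_mul, mem_add]
  constructor
  · rintro ⟨a, ha, b, hb, h⟩
    rcases List.append_eq_append_iff.1 h with ⟨c, rfl, rfl⟩ | ⟨c, rfl, rfl⟩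
    · exact .inr ⟨_, ⟨a, ha, c, rfl, rfl⟩, hb⟩
    · exact .inl ⟨c, ha, b, hb, rfl⟩
  · rintro (⟨a, ha, b, hb, rfl⟩ | ⟨_, ⟨u, hu, v, rfl, rfl⟩, hy⟩)
    · exact ⟨x ++ a, ha, b, hb, by simp⟩
    · exact ⟨u, hu, v ++ y, hy, by simp⟩

theorem IsRegular.mul {L M : Language α} (hL : L.IsRegular) (hM : M.IsRegular) :
    (L * M).IsRegular := by
  refine .of_finite_range_leftQuotient
    (((hL.finite_range_leftQuotient.prod hM.finite_range_leftQuotient.finite_subsets).image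
      fun p : Language α × Set (Language α) => p.1 * M + unionOf p.2).subset ?_)
  rintro _ ⟨x, rfl⟩
  refine ⟨(L.leftQuotient x, {K | ∃ u ∈ L, ∃ v, u ++ v = x ∧ K = M.leftQuotient v}),
    ⟨⟨x, rfl⟩, ?_⟩, (leftQuotient_mul L M x).symm⟩
  rintro _ ⟨u, _, v, _, rfl⟩
  exact ⟨v, rfl⟩

/-- Cut the factorization at the factor of `L` that contains the end of `x`: the part of this factor
inside `x` is `v`, and complete factors precede it. -/
theorem exists_of_append_mem_kstar {L : Language α} {x y : List α} (hx : x ≠ [])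
    (h : x ++ y ∈ L∗) :
    ∃ u v, u ∈ L∗ ∧ u ++ v = x ∧ y ∈ L.leftQuotient v * L∗ := by
  obtain ⟨S, hS, hmem⟩ := mem_kstar.1 h
  clear h
  induction S generalizing x with
  | nil => simp_all
  | cons l S ih =>
    rw [List.flatten_cons] at hS
    have hl : l ∈ L := hmem l (by simp)
    have hS' : ∀ z ∈ S, z ∈ L := fun z hz => hmem z (by simp [hz])
    rcases List.append_eq_append_iff.1 hS with ⟨c, rfl, rfl⟩ | ⟨c, rfl, h2⟩
    · exact ⟨[], x, nil_mem_kstar _, rfl, append_mem_mul hl (join_mem_kstar hS')⟩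
    -- If `x` ends exactly with the factor `l`, the induction hypothesis needs a nonempty remainder
    -- and is not available; the last factor itself serves as `v`, with empty rest.
    · by_cases hc : c = []
      · subst hc
        refine ⟨[], l, nil_mem_kstar _, by simp, ?_⟩
        simp only [List.nil_append] at h2
        subst h2
        exact append_mem_mul (a := []) (by simpa [mem_leftQuotient] using hl) (join_mem_kstar hS')
      · obtain ⟨u, v, hu, rfl, hy⟩ := ih hc h2.symm hS'
        refine ⟨l ++ u, v, ?_, by simp, hy⟩
        obtain ⟨S', rfl, hm⟩ := mem_kstar.1 hu
        exact mem_kstar.2 ⟨l :: S', by simp, by simpa [hl] using hm⟩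

theorem append_mem_kstar {L : Language α} {x y : List α} (hx : x ∈ L∗) (hy : y ∈ L∗) :
    x ++ y ∈ L∗ := by
  obtain ⟨S, rfl, hS⟩ := mem_kstar.1 hx
  obtain ⟨S', rfl, hS'⟩ := mem_kstar.1 hy
  exact mem_kstar.2 ⟨S ++ S', by simp, by
    intro z hz
    rcases List.mem_append.1 hz with h | h
    exacts [hS z h, hS' z h]⟩

theorem mem_kstar_of_mem {L : Language α} {x : List α} (hx : x ∈ L) : x ∈ L∗ :=
  mem_kstar.2 ⟨[x], by simp, by simpa using hx⟩

/-- For nonempty `x` the quotient of `L∗` is a union of languages `K * L∗` with `K` from a set of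
quotients of `L`, and a finite set has finitely many subsets. -/
theorem IsRegular.kstar {L : Language α} (hL : L.IsRegular) : (L∗).IsRegular := by
  refine .of_finite_range_leftQuotient
    (((hL.finite_range_leftQuotient.finite_subsets.image
      fun S : Set (Language α) => unionOf ((fun K : Language α => K * L∗) '' S)).insert
        (L∗)).subset ?_)
  rintro _ ⟨x, rfl⟩
  by_cases hx : x = []
  · left
    subst hx
    rfl
  right
  refine ⟨{K | ∃ u ∈ L∗, ∃ v, u ++ v = x ∧ K = L.leftQuotient v}, ?_, ?_⟩
  · rintro _ ⟨u, _, v, _, rfl⟩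
    exact ⟨v, rfl⟩
  · ext y
    constructor
    · rintro ⟨_, ⟨_, ⟨u, hu, v, rfl, rfl⟩, rfl⟩, hy⟩
      obtain ⟨a, ha, b, hb, rfl⟩ := mem_mul.1 hy
      have : u ++ ((v ++ a) ++ b) ∈ L∗ :=
        append_mem_kstar hu (append_mem_kstar (mem_kstar_of_mem ha) hb)
      simpa [mem_leftQuotient] using this
    · intro hy
      obtain ⟨u, v, hu, hv, hy'⟩ := exists_of_append_mem_kstar hx hy
      exact ⟨_, ⟨_, ⟨u, hu, v, hv, rfl⟩, rfl⟩, hy'⟩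

end Language

/-! ### Register programs as regular languages, and pairing of numbers. -/

/-- Instructions of nondeterministic register programs: the first three modify a register, the last
one checks that two registers hold the same number. -/
inductive Instr
  | clear (i : ℕ)
  | inc (i : ℕ)
  | add (i j : ℕ)
  | eq (i j : ℕ)
  deriving DecidableEq

namespace Instr

/-- The register contents after the instruction. -/
def next : Instr → (ℕ → ℕ) → ℕ → ℕ
  | clear i, v => Function.update v i 0
  | inc i, v => Function.update v i (v i + 1)
  | add i j, v => Function.update v i (v i + v j)
  | eq _ _, v => v

/-- The condition that an instruction checks. -/
def Passes : Instr → (ℕ → ℕ) → Prop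
  | eq i j, v => v i = v j
  | _, _ => True

/-- The word `w` of instructions passes all its checks and leads from `v` to `v'`. -/
def Exec : List Instr → (ℕ → ℕ) → (ℕ → ℕ) → Prop
  | [], v, v' => v' = v
  | a :: w, v, v' => a.Passes v ∧ Exec w (a.next v) v'

theorem exec_append {w w' : List Instr} {v v' : ℕ → ℕ} :
    Exec (w ++ w') v v' ↔ ∃ u, Exec w v u ∧ Exec w' u v' := by
  induction w generalizing v with
  | nil => simp [Exec]
  | cons a w ih => simp [Exec, ih, and_assoc]

open scoped Computability

/-- Some word of the language leads from `v` to `v'`. -/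
def Run (L : Language Instr) (v v' : ℕ → ℕ) : Prop := ∃ w ∈ L, Exec w v v'

theorem run_singleton {a : Instr} {v v' : ℕ → ℕ} :
    Run {[a]} v v' ↔ a.Passes v ∧ v' = a.next v := by
  have : ∀ w, w ∈ ({[a]} : Language Instr) ↔ w = [a] := fun w => Iff.rfl
  simp [Run, this, Exec]

/-- With `run_add` and `run_kstar`, this makes `Run` a translation from regular expressions to
relations, so that programs can be analysed without looking at words. -/
theorem run_mul {L M : Language Instr} {v v' : ℕ → ℕ} :
    Run (L * M) v v' ↔ ∃ u, Run L v u ∧ Run M u v' := by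
  constructor
  · rintro ⟨_, h, hw⟩
    obtain ⟨a, ha, b, hb, rfl⟩ := Language.mem_mul.1 h
    obtain ⟨u, h1, h2⟩ := exec_append.1 hw
    exact ⟨u, ⟨a, ha, h1⟩, ⟨b, hb, h2⟩⟩
  · rintro ⟨u, ⟨a, ha, h1⟩, ⟨b, hb, h2⟩⟩
    exact ⟨a ++ b, Language.append_mem_mul ha hb, exec_append.2 ⟨u, h1, h2⟩⟩

theorem run_add {L M : Language Instr} {v v' : ℕ → ℕ} :
    Run (L + M) v v' ↔ Run L v v' ∨ Run M v v' := by
  simp only [Run, Language.mem_add, or_and_right, exists_or]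

theorem run_kstar {L : Language Instr} {v v' : ℕ → ℕ} :
    Run L∗ v v' ↔ Relation.ReflTransGen (Run L) v v' := by
  constructor
  · rintro ⟨_, h, hw⟩
    obtain ⟨S, rfl, hS⟩ := Language.mem_kstar.1 h
    clear h
    induction S generalizing v with
    | nil =>
      obtain rfl : v' = v := hw
      exact .refl
    | cons l S ih =>
      rw [List.flatten_cons] at hw
      obtain ⟨u, h1, h2⟩ := exec_append.1 hw
      exact .head ⟨l, hS l (by simp), h1⟩ (ih (fun z hz => hS z (by simp [hz])) h2)
  · intro h
    induction h using Relation.ReflTransGen.head_induction_on with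
    | refl => exact ⟨[], Language.nil_mem_kstar _, rfl⟩
    | head h1 _ ih =>
      obtain ⟨a, ha, h1⟩ := h1
      obtain ⟨b, hb, h2⟩ := ih
      exact ⟨a ++ b, Language.append_mem_kstar (Language.mem_kstar_of_mem ha) hb,
        exec_append.2 ⟨_, h1, h2⟩⟩

/-- A program is a regular language of instruction words over finitely many instructions. -/
structure IsProgram (L : Language Instr) : Prop where
  regular : L.IsRegular
  finite : ∃ S : Finset Instr, ∀ w ∈ L, ∀ a ∈ w, a ∈ S

theorem IsProgram.singleton (a : Instr) : IsProgram {[a]} := by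
  refine ⟨Language.isRegular_singleton_singleton a, {a}, fun w hw b hb => ?_⟩
  obtain rfl : w = [a] := hw
  simpa using hb

theorem IsProgram.add {L M : Language Instr} (hL : IsProgram L) (hM : IsProgram M) :
    IsProgram (L + M) := by
  obtain ⟨S, hS⟩ := hL.finite
  obtain ⟨T, hT⟩ := hM.finite
  refine ⟨hL.regular.add hM.regular, S ∪ T, fun w hw a ha => Finset.mem_union.2 ?_⟩
  exact ((Language.mem_add _ _ _).1 hw).imp (hS w · a ha) (hT w · a ha)

theorem IsProgram.mul {L M : Language Instr} (hL : IsProgram L) (hM : IsProgram M) :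
    IsProgram (L * M) := by
  obtain ⟨S, hS⟩ := hL.finite
  obtain ⟨T, hT⟩ := hM.finite
  refine ⟨hL.regular.mul hM.regular, S ∪ T, fun w hw a ha => Finset.mem_union.2 ?_⟩
  obtain ⟨x, hx, y, hy, rfl⟩ := Language.mem_mul.1 hw
  exact (List.mem_append.1 ha).imp (hS x hx a) (hT y hy a)

theorem IsProgram.kstar {L : Language Instr} (hL : IsProgram L) : IsProgram L∗ := by
  obtain ⟨S, hS⟩ := hL.finite
  refine ⟨hL.regular.kstar, S, fun w hw a ha => ?_⟩
  obtain ⟨l, rfl, hl⟩ := Language.mem_kstar.1 hw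
  obtain ⟨x, hx, ha⟩ := List.mem_flatten.1 ha
  exact hS x (hl x hx) a ha

/-- Copy register `j` to register `i`. -/
def copy (i j : ℕ) : Language Instr := {[clear i]} * {[add i j]}

/-- Put an arbitrary number into register `i`. -/
def guess (i : ℕ) : Language Instr := {[clear i]} * {[inc i]}∗

theorem IsProgram.copy (i j : ℕ) : IsProgram (copy i j) := (singleton _).mul (singleton _)

theorem IsProgram.guess (i : ℕ) : IsProgram (guess i) := (singleton _).mul (singleton _).kstar

@[simp]
theorem run_clear {i : ℕ} {v v' : ℕ → ℕ} :
    Run {[clear i]} v v' ↔ v' = Function.update v i 0 := by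
  simp [run_singleton, Passes, next]

@[simp]
theorem run_inc {i : ℕ} {v v' : ℕ → ℕ} :
    Run {[inc i]} v v' ↔ v' = Function.update v i (v i + 1) := by
  simp [run_singleton, Passes, next]

@[simp]
theorem run_instr_add {i j : ℕ} {v v' : ℕ → ℕ} :
    Run {[add i j]} v v' ↔ v' = Function.update v i (v i + v j) := by
  simp [run_singleton, Passes, next]

@[simp]
theorem run_eq {i j : ℕ} {v v' : ℕ → ℕ} :
    Run {[eq i j]} v v' ↔ v i = v j ∧ v' = v := by
  simp [run_singleton, Passes, next]

theorem run_copy {i j : ℕ} (h : i ≠ j) {v v' : ℕ → ℕ} :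
    Run (copy i j) v v' ↔ v' = Function.update v i (v j) := by
  simp [copy, run_mul, h.symm]

@[simp]
theorem run_guess {i : ℕ} {v v' : ℕ → ℕ} :
    Run (guess i) v v' ↔ ∃ n, v' = Function.update v i n := by
  simp only [guess, run_mul, run_clear, run_kstar, exists_eq_left]
  constructor
  · intro h
    induction h with
    | refl => exact ⟨0, rfl⟩
    | tail _ h ih =>
      obtain ⟨n, rfl⟩ := ih
      exact ⟨n + 1, by simpa using h⟩
  · rintro ⟨n, rfl⟩
    induction n with
    | zero => exact .refl
    | succ n ih => exact ih.tail (by simp)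

/-- The program puts a number `y` with `R v y` into register `t` and preserves the registers
before `t`; all `y` with `R v y` are possible. -/
structure Sets (L : Language Instr) (t : ℕ) (R : (ℕ → ℕ) → ℕ → Prop) : Prop where
  isProgram : IsProgram L
  frame : ∀ {v v'}, Run L v v' → ∀ j < t, v' j = v j
  sound : ∀ {v v'}, Run L v v' → R v (v' t)
  complete : ∀ {v y}, R v y → ∃ v', Run L v v' ∧ v' t = y

/-- Put the square of register `x` into register `t`. -/
def square (t x : ℕ) : Language Instr :=
  {[clear t]} * {[clear (t + 1)]} * ({[add t x]} * {[inc (t + 1)]})∗ * {[eq (t + 1) x]}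

theorem IsProgram.square (t x : ℕ) : IsProgram (square t x) :=
  (((singleton _).mul (singleton _)).mul ((singleton _).mul (singleton _)).kstar).mul (singleton _)

/-- The star iterates any number of times, with `t + 1` as counter; the final check keeps only the
run with `v x` rounds. -/
theorem run_square {t x : ℕ} (h : x < t) {v v' : ℕ → ℕ} :
    Run (square t x) v v' ↔
      v' = Function.update (Function.update v t (v x * v x)) (t + 1) (v x) := by
  have key : ∀ {u}, Relation.ReflTransGen (Run ({[Instr.add t x]} * {[inc (t + 1)]}))
      (Function.update (Function.update v t 0) (t + 1) 0) u ↔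
      ∃ n, u = Function.update (Function.update v t (n * v x)) (t + 1) n := by
    intro u
    have step : ∀ n, Function.update (Function.update v t ((n + 1) * v x)) (t + 1) (n + 1) =
        Function.update (Function.update (Function.update (Function.update v t (n * v x))
          (t + 1) n) t (n * v x + v x)) (t + 1) (n + 1) := by
      intro n
      ext j
      simp only [Function.update_apply]
      grind
    have step' : ∀ n w, Run ({[Instr.add t x]} * {[inc (t + 1)]})
        (Function.update (Function.update v t (n * v x)) (t + 1) n) w ↔
        w = Function.update (Function.update v t ((n + 1) * v x)) (t + 1) (n + 1) := by
      intro n w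
      simp only [run_mul, run_instr_add, run_inc, exists_eq_left, step]
      simp [show x ≠ t by omega, show x ≠ t + 1 by omega]
    constructor
    · intro h
      induction h with
      | refl => exact ⟨0, by simp⟩
      | tail _ h ih =>
        obtain ⟨n, rfl⟩ := ih
        exact ⟨n + 1, (step' _ _).1 h⟩
    · rintro ⟨n, rfl⟩
      induction n with
      | zero => simpa using .refl
      | succ n ih => exact ih.tail ((step' _ _).2 rfl)
  simp only [square, run_mul, run_clear, exists_eq_left, run_kstar, key, run_eq]
  simp [show x ≠ t by omega, show x ≠ t + 1 by omega]

/-- Put the code of the pair of the registers `x` and `y` into register `t`. -/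
def pair (t x y : ℕ) : Language Instr :=
  guess (t + 2) *
    ({[inc (t + 2)]} * {[add (t + 2) x]} * {[eq (t + 2) y]} * square t y * {[add t x]} +
      {[add (t + 2) y]} * {[eq (t + 2) x]} * square t x * {[add t x]} * {[add t y]})

/-- `Nat.pair` is defined by cases on `v x < v y`. The program guesses the case along with a witness
for the inequality in register `t + 2`, so a wrong case cannot pass its check. -/
theorem sets_pair {t x y : ℕ} (hx : x < t) (hy : y < t) :
    Sets (pair t x y) t fun v n => n = Nat.pair (v x) (v y) := by
  have key : ∀ {v v'}, Run (pair t x y) v v' ↔ ∃ n,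
      (n + 1 + v x = v y ∧ v' = Function.update (Function.update (Function.update (Function.update v
        (t + 2) (n + 1 + v x)) t (v y * v y)) (t + 1) (v y)) t (v y * v y + v x)) ∨
      (n + v y = v x ∧ v' = Function.update (Function.update (Function.update (Function.update v
        (t + 2) (n + v y)) t (v x * v x)) (t + 1) (v x)) t (v x * v x + v x + v y)) := by
    intro v v'
    simp only [pair, run_mul, run_add, run_guess, run_instr_add, run_inc, run_eq, run_square hx,
      run_square hy]
    simp [show x ≠ t by omega, show x ≠ t + 1 by omega, show x ≠ t + 2 by omega,
      show y ≠ t by omega, show y ≠ t + 1 by omega, show y ≠ t + 2 by omega]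
  have total : ∀ v, ∃ v', Run (pair t x y) v v' := by
    intro v
    simp only [key]
    rcases lt_or_ge (v x) (v y) with h | h
    -- The strict branch increments the guess, so the guess is one less than the difference.
    · exact ⟨_, v y - v x - 1, .inl ⟨by omega, rfl⟩⟩
    · exact ⟨_, v x - v y, .inr ⟨by omega, rfl⟩⟩
  have sound : ∀ {v v'}, Run (pair t x y) v v' → v' t = Nat.pair (v x) (v y) := by
    intro v v' h
    obtain ⟨n, ⟨h, rfl⟩ | ⟨h, rfl⟩⟩ := key.1 h
    · simp [Nat.pair, show v x < v y by omega]
    · simp [Nat.pair, show ¬ v x < v y by omega]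
  refine ⟨?_, ?_, sound, ?_⟩
  · exact (IsProgram.guess _).mul
      ((((((IsProgram.singleton _).mul (.singleton _)).mul (.singleton _)).mul (.square _ _)).mul
        (.singleton _)).add (((((IsProgram.singleton _).mul (.singleton _)).mul (.square _ _)).mul
        (.singleton _)).mul (.singleton _)))
  · intro v v' h j hj
    obtain ⟨n, ⟨h, rfl⟩ | ⟨h, rfl⟩⟩ := key.1 h <;>
      simp [show j ≠ t by omega, show j ≠ t + 1 by omega, show j ≠ t + 2 by omega]
  · rintro v _ rfl
    obtain ⟨v', h⟩ := total v
    exact ⟨v', h, sound h⟩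

/-- Replace the number in register `i` by its two components as a pair, in the registers `i + 1`
and `i + 2`. -/
def unpair (i : ℕ) : Language Instr :=
  guess (i + 1) * guess (i + 2) * pair (i + 3) (i + 1) (i + 2) * {[eq (i + 3) i]}

theorem IsProgram.unpair (i : ℕ) : IsProgram (unpair i) :=
  (((guess _).mul (guess _)).mul (sets_pair (by omega) (by omega)).isProgram).mul (singleton _)

/-- Inversion by guessing: both components are guessed, paired again and compared with register `i`;
injectivity of pairing does the rest. -/
theorem run_unpair {i : ℕ} {v v' : ℕ → ℕ} (h : Run (unpair i) v v') :
    (∀ j ≤ i, v' j = v j) ∧ v' (i + 1) = (v i).unpair.1 ∧ v' (i + 2) = (v i).unpair.2 := by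
  have hp := sets_pair (t := i + 3) (x := i + 1) (y := i + 2) (by omega) (by omega)
  simp only [unpair, run_mul, run_guess, run_eq] at h
  obtain ⟨u, ⟨_, ⟨_, ⟨a, rfl⟩, b, rfl⟩, h1⟩, h2, rfl⟩ := h
  have hf := hp.frame h1
  have hs := hp.sound h1
  simp only [ne_eq, Nat.add_left_cancel_iff, OfNat.one_ne_ofNat, not_false_eq_true,
    Function.update_of_ne, Function.update_self] at hs
  have hi : v' i = v i := by
    rw [hf i (by omega)]
    simp
  rw [← hi, ← h2, hs, Nat.unpair_pair, hf _ (by omega), hf _ (by omega)]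
  refine ⟨fun j hj => ?_, by simp, by simp⟩
  rw [hf j (by omega)]
  simp [show j ≠ i + 1 by omega, show j ≠ i + 2 by omega]

theorem exists_run_unpair (i : ℕ) (v : ℕ → ℕ) : ∃ v', Run (unpair i) v v' := by
  have hp := sets_pair (t := i + 3) (x := i + 1) (y := i + 2) (by omega) (by omega)
  obtain ⟨u, h1, h2⟩ := hp.complete (v := Function.update (Function.update v (i + 1)
    (v i).unpair.1) (i + 2) (v i).unpair.2) (y := v i) (by simp)
  refine ⟨u, ?_⟩
  simp only [unpair, run_mul, run_guess, run_eq]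
  refine ⟨u, ⟨_, ⟨_, ⟨_, rfl⟩, _, rfl⟩, h1⟩, ?_, rfl⟩
  rw [h2, hp.frame h1 i (by omega)]
  simp

end Instr

/-! ### Programs for all partial recursive functions. -/

namespace Instr

open scoped Computability

theorem Sets.of_iff {L : Language Instr} {t : ℕ} {R : (ℕ → ℕ) → ℕ → Prop} {F : (ℕ → ℕ) → ℕ → ℕ → ℕ}
    (hL : IsProgram L)
    (h : ∀ v v', Run L v v' ↔ ∃ y, R v y ∧ v' = F v y) (hF : ∀ v y, F v y t = y)
    (hF' : ∀ v y, ∀ j < t, F v y j = v j) : Sets L t R where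
  isProgram := hL
  frame hr := by
    obtain ⟨y, _, rfl⟩ := (h _ _).1 hr
    exact hF' _ _
  sound hr := by
    obtain ⟨y, hy, rfl⟩ := (h _ _).1 hr
    rwa [hF]
  complete hy := ⟨_, (h _ _).2 ⟨_, hy, rfl⟩, hF _ _⟩

theorem sets_clear (t : ℕ) : Sets {[clear t]} t fun _ y => y = 0 :=
  .of_iff (F := fun v y => Function.update v t y) (.singleton _) (by simp) (by simp)
    fun v y j hj => by simp [hj.ne]

theorem sets_inc (t : ℕ) : Sets {[inc t]} t fun v y => y = v t + 1 :=
  .of_iff (F := fun v y => Function.update v t y) (.singleton _) (by simp) (by simp)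
    fun v y j hj => by simp [hj.ne]

theorem sets_copy {t x : ℕ} (h : t ≠ x) : Sets (copy t x) t fun v y => y = v x :=
  .of_iff (F := fun v y => Function.update v t y) (.copy _ _) (by simp [run_copy h]) (by simp)
    fun v y j hj => by simp [hj.ne]

/-- A program that works on a single register can be run on the result of another one. -/
theorem Sets.comp {L M : Language Instr} {t : ℕ} {R : (ℕ → ℕ) → ℕ → Prop} {S : ℕ → ℕ → Prop}
    (hL : Sets L t R) (hM : Sets M t fun v => S (v t)) :
    Sets (L * M) t fun v y => ∃ z, R v z ∧ S z y where
  isProgram := hL.isProgram.mul hM.isProgram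
  frame h j hj := by
    obtain ⟨u, h1, h2⟩ := run_mul.1 h
    rw [hM.frame h2 j hj, hL.frame h1 j hj]
  sound h := by
    obtain ⟨u, h1, h2⟩ := run_mul.1 h
    exact ⟨_, hL.sound h1, hM.sound h2⟩
  complete := by
    rintro v y ⟨z, hz, hy⟩
    obtain ⟨u, h1, rfl⟩ := hL.complete hz
    obtain ⟨v', h2, rfl⟩ := hM.complete hy
    exact ⟨v', run_mul.2 ⟨u, h1, h2⟩, rfl⟩

/-- The programs of the family compute the partial function `f`, from any register to itself. -/
def Computes (L : ℕ → Language Instr) (f : ℕ →. ℕ) : Prop :=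
  ∀ t, Sets (L t) t fun v y => y ∈ f (v t)

theorem Sets.congr {L : Language Instr} {t : ℕ} {R S : (ℕ → ℕ) → ℕ → Prop} (h : Sets L t R)
    (hRS : ∀ v y, R v y ↔ S v y) : Sets L t S := by
  obtain rfl : R = S := by ext; apply hRS
  exact h

theorem Computes.apply_copy {L : ℕ → Language Instr} {f : ℕ →. ℕ} (h : Computes L f) {t x : ℕ}
    (hx : t ≠ x) : Sets (copy t x * L t) t fun v y => y ∈ f (v x) :=
  ((sets_copy hx).comp (S := fun z y => y ∈ f z) (h t)).congr (by simp)

theorem Computes.apply_pair {L : ℕ → Language Instr} {f : ℕ →. ℕ} (h : Computes L f) {t x y : ℕ}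
    (hx : x < t) (hy : y < t) :
    Sets (Instr.pair t x y * L t) t fun v z => z ∈ f (Nat.pair (v x) (v y)) :=
  ((sets_pair hx hy).comp (S := fun z y => y ∈ f z) (h t)).congr (by simp)

theorem Computes.comp {L M : ℕ → Language Instr} {f g : ℕ →. ℕ} (hf : Computes L f)
    (hg : Computes M g) : Computes (fun t => M t * L t) fun n => g n >>= f := fun t =>
  ((hg t).comp (S := fun z y => y ∈ f z) (hf t)).congr fun _ _ =>
    Part.mem_bind_iff.symm

theorem computes_left :
    Computes (fun t => unpair t * Instr.copy t (t + 1)) fun n => Part.some n.unpair.1 := fun t => by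
  refine ⟨(IsProgram.unpair t).mul (.copy _ _), ?_, ?_, ?_⟩
  · intro v v' h j hj
    obtain ⟨u, h1, h2⟩ := run_mul.1 h
    obtain rfl := (run_copy (by omega)).1 h2
    simp [hj.ne, (run_unpair h1).1 j hj.le]
  · intro v v' h
    obtain ⟨u, h1, h2⟩ := run_mul.1 h
    obtain rfl := (run_copy (by omega)).1 h2
    simp [(run_unpair h1).2]
  · intro v y hy
    obtain ⟨u, h1⟩ := exists_run_unpair t v
    refine ⟨_, run_mul.2 ⟨u, h1, (run_copy (by omega)).2 rfl⟩, ?_⟩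
    simpa [(run_unpair h1).2] using (Part.mem_some_iff.1 hy).symm

theorem computes_right :
    Computes (fun t => unpair t * Instr.copy t (t + 2)) fun n => Part.some n.unpair.2 := fun t => by
  refine ⟨(IsProgram.unpair t).mul (.copy _ _), ?_, ?_, ?_⟩
  · intro v v' h j hj
    obtain ⟨u, h1, h2⟩ := run_mul.1 h
    obtain rfl := (run_copy (by omega)).1 h2
    simp [hj.ne, (run_unpair h1).1 j hj.le]
  · intro v v' h
    obtain ⟨u, h1, h2⟩ := run_mul.1 h
    obtain rfl := (run_copy (by omega)).1 h2
    simp [(run_unpair h1).2]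
  · intro v y hy
    obtain ⟨u, h1⟩ := exists_run_unpair t v
    refine ⟨_, run_mul.2 ⟨u, h1, (run_copy (by omega)).2 rfl⟩, ?_⟩
    simpa [(run_unpair h1).2] using (Part.mem_some_iff.1 hy).symm

/-- Subprograms may destroy all registers from their base on, so every value still needed is kept
below the base of the next one: the argument in `t`, the results in `t + 1` and `t + 2`. -/
theorem Computes.pair {L M : ℕ → Language Instr} {f g : ℕ →. ℕ} (hf : Computes L f)
    (hg : Computes M g) :
    Computes (fun t => Instr.copy (t + 1) t * L (t + 1) * (Instr.copy (t + 2) t * M (t + 2)) *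
        Instr.pair (t + 3) (t + 1) (t + 2) * Instr.copy t (t + 3))
      fun n => Nat.pair <$> f n <*> g n := fun t => by
  have hF := hf.apply_copy (t := t + 1) (x := t) (by omega)
  have hG := hg.apply_copy (t := t + 2) (x := t) (by omega)
  have hP := sets_pair (t := t + 3) (x := t + 1) (y := t + 2) (by omega) (by omega)
  have hmem : ∀ n y, y ∈ (Nat.pair <$> f n <*> g n : Part ℕ) ↔
      ∃ a ∈ f n, ∃ b ∈ g n, y = Nat.pair a b := by
    intro n y
    simp [Seq.seq, eq_comm]
  refine ⟨(((hF.isProgram.mul hG.isProgram).mul hP.isProgram).mul (.copy _ _)), ?_, ?_, ?_⟩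
  · intro v v' h j hj
    simp only [run_mul (M := Instr.copy _ _), run_mul (M := Instr.pair _ _ _),
      run_mul (M := Instr.copy _ _ * _)] at h
    obtain ⟨w, ⟨x, ⟨u, h1, h2⟩, h3⟩, h4⟩ := h
    obtain rfl := (run_copy (by omega)).1 h4
    simp only [Function.update_of_ne hj.ne]
    rw [hP.frame h3 _ (by omega), hG.frame h2 _ (by omega), hF.frame h1 _ (by omega)]
  · intro v v' h
    simp only [run_mul (M := Instr.copy _ _), run_mul (M := Instr.pair _ _ _),
      run_mul (M := Instr.copy _ _ * _)] at h
    obtain ⟨w, ⟨x, ⟨u, h1, h2⟩, h3⟩, h4⟩ := h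
    obtain rfl := (run_copy (by omega)).1 h4
    rw [hmem, Function.update_self]
    have h5 := hG.sound h2
    rw [hF.frame h1 _ (by omega)] at h5
    exact ⟨_, hF.sound h1, _, h5, by rw [hP.sound h3, hG.frame h2 _ (by omega)]⟩
  · intro v y hy
    obtain ⟨a, ha, b, hb, rfl⟩ := (hmem _ _).1 hy
    obtain ⟨u, h1, rfl⟩ := hF.complete ha
    obtain ⟨x, h2, rfl⟩ := hG.complete (v := u) (y := b) (by rwa [hF.frame h1 _ (by omega)])
    obtain ⟨w, h3, h4⟩ := hP.complete (v := x) rfl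
    refine ⟨_, run_mul.2 ⟨w, run_mul.2 ⟨x, run_mul.2 ⟨u, h1, h2⟩, h3⟩,
      (run_copy (by omega)).2 rfl⟩, ?_⟩
    rw [Function.update_self, h4, hG.frame h2 _ (by omega)]

/-- One round of primitive recursion: register `t + 3` counts the rounds, register `t + 4` holds
the value. -/
def precStep (M : ℕ → Language Instr) (t : ℕ) : Language Instr :=
  Instr.pair (t + 5) (t + 3) (t + 4) * (Instr.pair (t + 6) (t + 1) (t + 5) * M (t + 6)) *
    Instr.copy (t + 4) (t + 6) * {[inc (t + 3)]}

theorem run_precStep {M : ℕ → Language Instr} {g : ℕ →. ℕ} (hg : Computes M g) {t : ℕ}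
    {v v' : ℕ → ℕ} (h : Run (precStep M t) v v') :
    (∀ j < t + 3, v' j = v j) ∧ v' (t + 3) = v (t + 3) + 1 ∧
      v' (t + 4) ∈ g (Nat.pair (v (t + 1)) (Nat.pair (v (t + 3)) (v (t + 4)))) := by
  have hP := sets_pair (t := t + 5) (x := t + 3) (y := t + 4) (by omega) (by omega)
  have hG := hg.apply_pair (t := t + 6) (x := t + 1) (y := t + 5) (by omega) (by omega)
  simp only [precStep, run_mul (M := Instr.copy _ _), run_mul (M := {[inc _]}),
    run_mul (M := Instr.pair _ _ _ * _)] at h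
  obtain ⟨w, ⟨x, ⟨u, h1, h2⟩, h3⟩, h4⟩ := h
  obtain rfl := (run_copy (by omega)).1 h3
  obtain rfl := run_inc.1 h4
  refine ⟨fun j hj => ?_, ?_, ?_⟩
  · simp only [Function.update_of_ne hj.ne, Function.update_of_ne (show j ≠ t + 4 by omega)]
    rw [hG.frame h2 _ (by omega), hP.frame h1 _ (by omega)]
  · simp [hG.frame h2 (t + 3) (by omega), hP.frame h1 (t + 3) (by omega)]
  · have := hG.sound h2
    rw [hP.sound h1, hP.frame h1 _ (by omega)] at this
    simpa using this

theorem exists_run_precStep {M : ℕ → Language Instr} {g : ℕ →. ℕ} (hg : Computes M g) {t : ℕ}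
    {v : ℕ → ℕ} {y : ℕ} (hy : y ∈ g (Nat.pair (v (t + 1)) (Nat.pair (v (t + 3)) (v (t + 4))))) :
    ∃ v', Run (precStep M t) v v' ∧ v' (t + 4) = y := by
  have hP := sets_pair (t := t + 5) (x := t + 3) (y := t + 4) (by omega) (by omega)
  have hG := hg.apply_pair (t := t + 6) (x := t + 1) (y := t + 5) (by omega) (by omega)
  obtain ⟨u, h1, h2⟩ := hP.complete (v := v) rfl
  obtain ⟨w, h3, h4⟩ := hG.complete (v := u) (y := y)
    (by rwa [hP.frame h1 _ (by omega), h2])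
  exact ⟨_, run_mul.2 ⟨_, run_mul.2 ⟨w, run_mul.2 ⟨u, h1, h3⟩, (run_copy (by omega)).2 rfl⟩,
    run_inc.2 rfl⟩, by simp [h4]⟩

/-- Registers `t + 1` and `t + 2` hold the parameter and the number of rounds. The loop invariant is
that `t + 4` holds a value of the recursion at the counter `t + 3`; the check after the star forces
the right number of rounds. -/
theorem Computes.prec {L M : ℕ → Language Instr} {f g : ℕ →. ℕ} (hf : Computes L f)
    (hg : Computes M g) :
    Computes (fun t => unpair t * {[clear (t + 3)]} * (Instr.copy (t + 4) (t + 1) * L (t + 4)) *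
        (precStep M t)∗ * {[eq (t + 3) (t + 2)]} * Instr.copy t (t + 4))
      (Nat.unpaired fun a n => n.rec (f a) fun y IH => do
        let i ← IH
        g (Nat.pair a (Nat.pair y i))) := fun t => by
  set F : ℕ → ℕ → Part ℕ := fun a n => n.rec (f a) fun y IH => do
    let i ← IH
    g (Nat.pair a (Nat.pair y i)) with hFdef
  have hF0 : ∀ a, F a 0 = f a := fun a => rfl
  have hFs : ∀ a n y, y ∈ F a (n + 1) ↔ ∃ i ∈ F a n, y ∈ g (Nat.pair a (Nat.pair n i)) :=
    fun a n y => Part.mem_bind_iff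
  have hL := hf.apply_copy (t := t + 4) (x := t + 1) (by omega)
  have hprog : IsProgram (precStep M t) :=
    (((sets_pair (by omega) (by omega)).isProgram.mul
      (hg.apply_pair (by omega) (by omega)).isProgram).mul (.copy _ _)).mul (.singleton _)
  have loop : ∀ {v v'}, Relation.ReflTransGen (Run (precStep M t)) v v' →
      v (t + 4) ∈ F (v (t + 1)) (v (t + 3)) →
      (∀ j < t + 3, v' j = v j) ∧ v' (t + 4) ∈ F (v' (t + 1)) (v' (t + 3)) := by
    intro v v' h h0
    induction h with
    | refl => exact ⟨fun _ _ => rfl, h0⟩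
    | tail _ h ih =>
      obtain ⟨h1, h2, h3⟩ := run_precStep hg h
      refine ⟨fun j hj => (h1 j hj).trans (ih.1 j hj), ?_⟩
      rw [h2, hFs, h1 _ (by omega)]
      exact ⟨_, ih.2, h3⟩
  have sound : ∀ {v v'}, Run (unpair t * {[clear (t + 3)]} *
      (Instr.copy (t + 4) (t + 1) * L (t + 4)) * (precStep M t)∗ * {[eq (t + 3) (t + 2)]} *
      Instr.copy t (t + 4)) v v' →
      (∀ j < t, v' j = v j) ∧ v' t ∈ F (v t).unpair.1 (v t).unpair.2 := by
    intro v v' h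
    simp only [run_mul (M := Instr.copy _ _), run_mul (M := {[eq _ _]}), run_mul (M := _∗),
      run_mul (M := Instr.copy _ _ * _), run_mul (M := {[clear _]}), run_clear, run_eq,
      run_kstar, run_copy (show t ≠ t + 4 by omega)] at h
    obtain ⟨_, ⟨w, ⟨x, ⟨_, ⟨u, h1, rfl⟩, h2⟩, h3⟩, h4, rfl⟩, rfl⟩ := h
    obtain ⟨h5, h6, h7⟩ := run_unpair h1
    have h8 := hL.sound h2
    have h9 := hL.frame h2
    have h10 : x (t + 1) = u (t + 1) := by simp [h9 (t + 1) (by omega)]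
    have h11 : x (t + 2) = u (t + 2) := by simp [h9 (t + 2) (by omega)]
    have h12 : x (t + 3) = 0 := by simp [h9 (t + 3) (by omega)]
    obtain ⟨h13, h14⟩ := loop h3 (by rw [h12, hF0, h10]; simpa using h8)
    refine ⟨fun j hj => ?_, ?_⟩
    · rw [Function.update_of_ne hj.ne, h13 _ (by omega), h9 _ (by omega),
        Function.update_of_ne (by omega), h5 _ hj.le]
    · rw [Function.update_self, ← h6, ← h7, ← h10, ← h11, ← h13 _ (by omega), ← h13 _ (by omega),
        ← h4]
      exact h14
  refine ⟨(((((IsProgram.unpair t).mul (.singleton _)).mul hL.isProgram).mul hprog.kstar).mul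
    (.singleton _)).mul (.copy _ _), fun h => (sound h).1, fun h => (sound h).2, ?_⟩
  intro v y hy
  obtain ⟨u, h1⟩ := exists_run_unpair t v
  obtain ⟨h5, h6, h7⟩ := run_unpair h1
  have reach : ∀ n, ∀ y ∈ F (u (t + 1)) n, ∃ x w, Run (Instr.copy (t + 4) (t + 1) * L (t + 4))
      (Function.update u (t + 3) 0) x ∧ Relation.ReflTransGen (Run (precStep M t)) x w ∧
      (∀ j < t + 3, w j = u j) ∧ w (t + 3) = n ∧ w (t + 4) = y := by
    intro n
    induction n with
    | zero =>
      intro y hy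
      obtain ⟨x, h2, h3⟩ := hL.complete (v := Function.update u (t + 3) 0) (y := y)
        (by rw [hF0] at hy; simpa using hy)
      have h9 := hL.frame h2
      refine ⟨x, x, h2, .refl, fun j hj => ?_, ?_, h3⟩
      · rw [h9 _ (by omega), Function.update_of_ne hj.ne]
      · rw [h9 _ (by omega), Function.update_self]
    | succ n ih =>
      intro y hy
      obtain ⟨i, hi, hy⟩ := (hFs _ _ _).1 hy
      obtain ⟨x, w, h2, h3, h4, rfl, rfl⟩ := ih i hi
      obtain ⟨w', h8, h9⟩ := exists_run_precStep hg (t := t) (v := w) (y := y)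
        (by rwa [h4 _ (by omega)])
      obtain ⟨h10, h11, -⟩ := run_precStep hg h8
      exact ⟨x, w', h2, h3.tail h8, fun j hj => (h10 j hj).trans (h4 j hj), h11, h9⟩
  obtain ⟨x, w, h2, h3, h4, h8, h9⟩ := reach (u (t + 2)) y (by rw [h6, h7]; exact hy)
  refine ⟨Function.update w t (w (t + 4)), ?_, by simp [h9]⟩
  refine run_mul.2 ⟨w, run_mul.2 ⟨w, run_mul.2 ⟨x, run_mul.2 ⟨_, run_mul.2 ⟨u, h1,
    run_clear.2 rfl⟩, h2⟩, run_kstar.2 h3⟩, run_eq.2 ⟨?_, rfl⟩⟩, (run_copy (by omega)).2 rfl⟩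
  rw [h8, h4 _ (by omega)]

/-- One round of unbounded search: check that the value at register `t + 1` is nonzero and
increase that register. -/
def searchStep (L : ℕ → Language Instr) (t : ℕ) : Language Instr :=
  Instr.pair (t + 2) t (t + 1) * L (t + 2) * guess (t + 3) * {[inc (t + 3)]} *
    {[eq (t + 2) (t + 3)]} * {[inc (t + 1)]}

theorem run_searchStep {L : ℕ → Language Instr} {f : ℕ →. ℕ} (hf : Computes L f) {t : ℕ}
    {v v' : ℕ → ℕ} (h : Run (searchStep L t) v v') :
    (∀ j ≤ t, v' j = v j) ∧ v' (t + 1) = v (t + 1) + 1 ∧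
      ∃ m ∈ f (Nat.pair (v t) (v (t + 1))), m ≠ 0 := by
  have hF := hf.apply_pair (t := t + 2) (x := t) (y := t + 1) (by omega) (by omega)
  simp only [searchStep, run_mul (M := {[inc _]}), run_mul (M := {[eq _ _]}),
    run_mul (M := guess _), run_guess, run_inc, run_eq] at h
  obtain ⟨_, ⟨_, ⟨_, ⟨u, h1, n, rfl⟩, rfl⟩, h2, rfl⟩, rfl⟩ := h
  refine ⟨fun j hj => ?_, ?_, _, hF.sound h1, ?_⟩
  · simp only [Function.update_of_ne (show j ≠ t + 1 by omega),
      Function.update_of_ne (show j ≠ t + 3 by omega)]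
    exact hF.frame h1 _ (by omega)
  · simp [hF.frame h1 (t + 1) (by omega)]
  · simp at h2
    omega

theorem exists_run_searchStep {L : ℕ → Language Instr} {f : ℕ →. ℕ} (hf : Computes L f) {t : ℕ}
    {v : ℕ → ℕ} {m : ℕ} (hm : m ∈ f (Nat.pair (v t) (v (t + 1)))) (h0 : m ≠ 0) :
    ∃ v', Run (searchStep L t) v v' := by
  have hF := hf.apply_pair (t := t + 2) (x := t) (y := t + 1) (by omega) (by omega)
  obtain ⟨u, h1, h2⟩ := hF.complete hm
  refine ⟨_, run_mul.2 ⟨_, run_mul.2 ⟨_, run_mul.2 ⟨_, run_mul.2 ⟨u, h1,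
    -- A number is nonzero iff it equals an incremented guess, here that of its predecessor.
    run_guess.2 ⟨m - 1, rfl⟩⟩, run_inc.2 rfl⟩, run_eq.2 ⟨?_, rfl⟩⟩, run_inc.2 rfl⟩⟩
  simp
  omega

/-- Every round certifies a nonzero value before moving on, and after the star the value is checked
to be 0. Hence stopping too early or too late is impossible. -/
theorem Computes.rfind {L : ℕ → Language Instr} {f : ℕ →. ℕ} (hf : Computes L f) :
    Computes (fun t => {[clear (t + 1)]} * (searchStep L t)∗ *
        (Instr.pair (t + 2) t (t + 1) * L (t + 2)) * {[clear (t + 3)]} * {[eq (t + 2) (t + 3)]} *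
        Instr.copy t (t + 1))
      fun a => Nat.rfind fun n => (fun m => m = 0) <$> f (Nat.pair a n) := fun t => by
  have hF := hf.apply_pair (t := t + 2) (x := t) (y := t + 1) (by omega) (by omega)
  have hmem : ∀ a n, (n ∈ Nat.rfind fun n => (fun m => m = 0) <$> f (Nat.pair a n)) ↔
      0 ∈ f (Nat.pair a n) ∧ ∀ m < n, ∃ y ∈ f (Nat.pair a m), y ≠ 0 := by
    intro a n
    refine Nat.mem_rfind.trans ?_
    simp
  have hprog : IsProgram (searchStep L t) :=
    (((hF.isProgram.mul (.guess _)).mul (.singleton _)).mul (.singleton _)).mul (.singleton _)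
  have loop : ∀ {v v'}, Relation.ReflTransGen (Run (searchStep L t)) v v' → v (t + 1) = 0 →
      (∀ j ≤ t, v' j = v j) ∧ ∀ m < v' (t + 1), ∃ y ∈ f (Nat.pair (v t) m), y ≠ 0 := by
    intro v v' h h0
    induction h with
    | refl => exact ⟨fun _ _ => rfl, by simp [h0]⟩
    | tail _ h ih =>
      obtain ⟨h1, h2, h3⟩ := run_searchStep hf h
      refine ⟨fun j hj => (h1 j hj).trans (ih.1 j hj), fun m hm => ?_⟩
      rw [h2] at hm
      rcases (Nat.lt_succ_iff.1 hm).lt_or_eq with hm | rfl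
      · exact ih.2 m hm
      · rwa [ih.1 t le_rfl] at h3
  have sound : ∀ {v v'}, Run ({[clear (t + 1)]} * (searchStep L t)∗ *
        (Instr.pair (t + 2) t (t + 1) * L (t + 2)) * {[clear (t + 3)]} * {[eq (t + 2) (t + 3)]} *
        Instr.copy t (t + 1)) v v' →
      (∀ j < t, v' j = v j) ∧
        v' t ∈ Nat.rfind fun n => (fun m => m = 0) <$> f (Nat.pair (v t) n) := by
    intro v v' h
    simp only [run_mul (M := Instr.copy _ _), run_mul (M := {[eq _ _]}), run_mul (M := _∗),
      run_mul (M := Instr.pair _ _ _ * _), run_mul (M := {[clear _]}), run_clear, run_eq,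
      run_kstar, run_copy (show t ≠ t + 1 by omega), exists_eq_left] at h
    obtain ⟨_, ⟨_, ⟨w, ⟨u, h1, h2⟩, rfl⟩, h3, rfl⟩, rfl⟩ := h
    obtain ⟨h4, h5⟩ := loop h1 (by simp)
    have h4' : ∀ j ≤ t, u j = v j := fun j hj => by
      rw [h4 j hj, Function.update_of_ne (by omega)]
    have h6 := hF.frame h2
    have h7 := hF.sound h2
    simp only [ne_eq, Nat.add_left_cancel_iff, Nat.reduceEqDiff, not_false_eq_true,
      Function.update_of_ne, Function.update_self] at h3
    refine ⟨fun j hj => ?_, (hmem _ _).2 ⟨?_, fun m hm => ?_⟩⟩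
    · rw [Function.update_of_ne hj.ne, Function.update_of_ne (by omega), h6 _ (by omega),
        h4' _ hj.le]
    · rw [h3, h4' _ le_rfl] at h7
      simpa [h6 (t + 1) (by omega)] using h7
    · simp only [Function.update_self, ne_eq, Nat.add_left_cancel_iff, OfNat.one_ne_ofNat,
        not_false_eq_true, Function.update_of_ne, h6 (t + 1) (by omega)] at hm
      simpa using h5 m hm
  refine ⟨((((IsProgram.singleton _).mul hprog.kstar).mul hF.isProgram).mul (.singleton _)).mul
    (.singleton _) |>.mul (.copy _ _), fun h => (sound h).1, fun h => (sound h).2, ?_⟩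
  intro v n hn
  obtain ⟨hn0, hlt⟩ := (hmem _ _).1 hn
  have reach : ∀ k ≤ n, ∃ w, Relation.ReflTransGen (Run (searchStep L t))
      (Function.update v (t + 1) 0) w ∧ w t = v t ∧ w (t + 1) = k := by
    intro k
    induction k with
    | zero => exact fun _ => ⟨_, .refl, by simp, by simp⟩
    | succ k ih =>
      intro hk
      obtain ⟨w, h1, h2, rfl⟩ := ih (by omega)
      obtain ⟨m, hm, hm0⟩ := hlt (w (t + 1)) (by omega)
      obtain ⟨w', h3⟩ := exists_run_searchStep hf (v := w) (by rwa [h2]) hm0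
      obtain ⟨h4, h5, -⟩ := run_searchStep hf h3
      exact ⟨w', h1.tail h3, (h4 t le_rfl).trans h2, h5⟩
  obtain ⟨u, h1, h2, h3⟩ := reach n le_rfl
  obtain ⟨w, h4, h5⟩ := hF.complete (v := u) (y := 0) (by rwa [h2, h3])
  refine ⟨_, run_mul.2 ⟨_, run_mul.2 ⟨_, run_mul.2 ⟨w, run_mul.2 ⟨u, run_mul.2 ⟨_,
    run_clear.2 rfl, run_kstar.2 h1⟩, h4⟩, run_clear.2 rfl⟩, run_eq.2 ⟨by simp [h5], rfl⟩⟩,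
    (run_copy (by omega)).2 rfl⟩, ?_⟩
  simp [hF.frame h4 (t + 1) (by omega), h3]

theorem exists_computes {f : ℕ →. ℕ} (hf : Nat.Partrec f) : ∃ L, Computes L f := by
  induction hf with
  | zero => exact ⟨_, fun t => (sets_clear t).congr fun v y => Part.mem_some_iff.symm⟩
  | succ => exact ⟨_, fun t => (sets_inc t).congr fun v y => Part.mem_some_iff.symm⟩
  | left => exact ⟨_, computes_left⟩
  | right => exact ⟨_, computes_right⟩
  | pair _ _ ihf ihg =>
    obtain ⟨L, hL⟩ := ihf
    obtain ⟨M, hM⟩ := ihg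
    exact ⟨_, hL.pair hM⟩
  | comp _ _ ihf ihg =>
    obtain ⟨L, hL⟩ := ihf
    obtain ⟨M, hM⟩ := ihg
    exact ⟨_, hL.comp hM⟩
  | prec _ _ ihf ihg =>
    obtain ⟨L, hL⟩ := ihf
    obtain ⟨M, hM⟩ := ihg
    exact ⟨_, hL.prec hM⟩
  | rfind _ ih =>
    obtain ⟨L, hL⟩ := ih
    exact ⟨_, hL.rfind⟩

/-- The domain of a partial recursive function is the set of initial values of register `0` from
which some word of a program can be executed. -/
theorem exists_program_dom {f : ℕ →. ℕ} (hf : Nat.Partrec f) :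
    ∃ L, IsProgram L ∧ ∀ v, (f (v 0)).Dom ↔ ∃ v', Run L v v' := by
  obtain ⟨L, hL⟩ := exists_computes hf
  -- With base 0 all other registers are scratch space, so their initial contents are irrelevant;
  -- later register 1 also starts with `n`.
  refine ⟨L 0, (hL 0).isProgram, fun v => ⟨fun h => ?_, fun ⟨v', h⟩ => ?_⟩⟩
  · obtain ⟨v', h, -⟩ := (hL 0).complete (Part.get_mem h)
    exact ⟨v', h⟩
  · exact Part.dom_iff_mem.2 ⟨_, (hL 0).sound h⟩

end Instr

open Matrix

/-! ### The rejection probability and when it vanishes. -/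

namespace QFA

/-- All sequences of operation elements for the symbols lead from the (unnormalized) pure state `ψ`
into the kernel of `R`. -/
def NeverRejects {S ι : Type*} [Fintype ι] (ops : S → List (Matrix ι ι ℚ)) (R : Matrix ι ι ℚ) :
    List S → (ι → ℚ) → Prop
  | [], ψ => R *ᵥ ψ = 0
  | σ :: ts, ψ => ∀ E ∈ ops σ, NeverRejects ops R ts (E *ᵥ ψ)

variable (M : QFA ℚ)

theorem superop_add (σ) (ρ ρ' : Matrix (Fin M.numStates) (Fin M.numStates) ℚ) :
    M.superop σ (ρ + ρ') = M.superop σ ρ + M.superop σ ρ' := by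
  simp only [superop, mul_add, add_mul, List.sum_map_add]

theorem superop_zero (σ) : M.superop σ 0 = 0 := by
  simp [superop]

/-- The trace of the product of the rejecting projection with the final density operator. -/
def rejTrace (ts : List (Option (Fin M.numSymbols))) :
    Matrix (Fin M.numStates) (Fin M.numStates) ℚ →+ ℚ where
  toFun ρ := (M.projRej * ts.foldl (fun ρ σ => M.superop σ ρ) ρ).trace
  map_zero' := by
    have : ts.foldl (fun ρ σ => M.superop σ ρ) 0 = 0 := by
      induction ts with
      | nil => rfl
      | cons σ ts ih => rwa [List.foldl_cons, superop_zero]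
    simp [this]
  map_add' ρ ρ' := by
    have : ts.foldl (fun ρ σ => M.superop σ ρ) (ρ + ρ') =
        ts.foldl (fun ρ σ => M.superop σ ρ) ρ + ts.foldl (fun ρ σ => M.superop σ ρ) ρ' := by
      induction ts generalizing ρ ρ' with
      | nil => rfl
      | cons σ ts ih => rw [List.foldl_cons, superop_add, ih, List.foldl_cons, List.foldl_cons]
    simp [this, mul_add]

theorem rejTrace_cons (σ) (ts : List (Option (Fin M.numSymbols)))
    (ρ : Matrix (Fin M.numStates) (Fin M.numStates) ℚ) :
    M.rejTrace (σ :: ts) ρ = ((M.ops σ).map fun E => M.rejTrace ts (E * ρ * Eᴴ)).sum := by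
  have : M.rejTrace (σ :: ts) ρ = M.rejTrace ts (M.superop σ ρ) := rfl
  rw [this, superop, map_list_sum, List.map_map]
  rfl

theorem rejTrace_nil_vecMulVec (ψ : Fin M.numStates → ℚ) :
    M.rejTrace [] (vecMulVec ψ ψ) = (M.projRej *ᵥ ψ) ⬝ᵥ (M.projRej *ᵥ ψ) := by
  have h : M.rejTrace [] (vecMulVec ψ ψ) = (M.projRej * vecMulVec ψ ψ).trace := rfl
  have ht : M.projRejᵀ = M.projRej := by simpa [IsHermitian, conjTranspose_eq_transpose_of_trivial]
    using M.projRej_herm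
  rw [h, mul_vecMulVec, trace_vecMulVec, dotProduct_mulVec, ← mulVec_transpose, ht, mulVec_mulVec,
    M.projRej_idem]

theorem rejTrace_cons_vecMulVec (σ) (ts : List (Option (Fin M.numSymbols)))
    (ψ : Fin M.numStates → ℚ) :
    M.rejTrace (σ :: ts) (vecMulVec ψ ψ) =
      ((M.ops σ).map fun E => M.rejTrace ts (vecMulVec (E *ᵥ ψ) (E *ᵥ ψ))).sum := by
  rw [rejTrace_cons]
  simp [mul_vecMulVec, vecMulVec_mul, conjTranspose_eq_transpose_of_trivial, vecMul_transpose]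

theorem rejTrace_nonneg (ts : List (Option (Fin M.numSymbols))) (ψ : Fin M.numStates → ℚ) :
    0 ≤ M.rejTrace ts (vecMulVec ψ ψ) := by
  induction ts generalizing ψ with
  | nil =>
    rw [rejTrace_nil_vecMulVec]
    exact Finset.sum_nonneg fun i _ => mul_self_nonneg _
  | cons σ ts ih =>
    rw [rejTrace_cons_vecMulVec]
    exact List.sum_nonneg fun x hx => by
      obtain ⟨E, _, rfl⟩ := List.mem_map.1 hx
      exact ih _

/-- The trace is a sum of nonnegative terms, one for each sequence of operation elements, and each
is the squared length of a rational vector. -/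
theorem rejTrace_eq_zero_iff (ts : List (Option (Fin M.numSymbols))) (ψ : Fin M.numStates → ℚ) :
    M.rejTrace ts (vecMulVec ψ ψ) = 0 ↔ NeverRejects M.ops M.projRej ts ψ := by
  induction ts generalizing ψ with
  | nil =>
    rw [rejTrace_nil_vecMulVec, NeverRejects, dotProduct_self_eq_zero]
  | cons σ ts ih =>
    rw [rejTrace_cons_vecMulVec, NeverRejects]
    simp only [← ih]
    constructor
    · intro h E hE
      refine le_antisymm ?_ (M.rejTrace_nonneg ts _)
      rw [← h]
      refine List.single_le_sum (fun x hx => ?_) _ (List.mem_map.2 ⟨E, hE, rfl⟩)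
      obtain ⟨E, _, rfl⟩ := List.mem_map.1 hx
      exact M.rejTrace_nonneg _ _
    · intro h
      exact List.sum_eq_zero fun x hx => by
        obtain ⟨E, hE, rfl⟩ := List.mem_map.1 hx
        exact h E hE

theorem trace_superop (σ) (ρ : Matrix (Fin M.numStates) (Fin M.numStates) ℚ) :
    (M.superop σ ρ).trace = ρ.trace := by
  have h : ∀ l : List (Matrix (Fin M.numStates) (Fin M.numStates) ℚ),
      ((l.map fun A => A * ρ * Aᴴ).sum).trace = ((l.map fun A => Aᴴ * A).sum * ρ).trace := by
    intro l
    induction l with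
    | nil => simp
    | cons A l ih =>
      simp only [List.map_cons, List.sum_cons, trace_add, add_mul, ih]
      rw [trace_mul_comm (A * ρ), mul_assoc]
  rw [superop, h, M.ops_complete, one_mul]

theorem trace_finalState (w : List (Fin M.numSymbols)) : (M.finalState w).trace = 1 := by
  have h : ∀ (ts) (ρ : Matrix (Fin M.numStates) (Fin M.numStates) ℚ),
      (List.foldl (fun ρ σ => M.superop σ ρ) ρ ts).trace = ρ.trace := by
    intro ts
    induction ts with
    | nil => exact fun ρ => rfl
    | cons σ ts ih => exact fun ρ => by rw [List.foldl_cons, ih, trace_superop]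
  rw [finalState, h]
  simp

theorem accProb_lt_one_iff (w : List (Fin M.numSymbols)) :
    M.accProb w < 1 ↔ ¬ NeverRejects M.ops M.projRej (tape w) (Pi.single M.init 1) := by
  have h1 : M.accProb w + M.rejTrace (tape w) (vecMulVec (Pi.single M.init 1) (Pi.single M.init 1))
      = 1 := by
    rw [← single_eq_single_vecMulVec_single]
    change (M.projAcc * M.finalState w).trace + (M.projRej * M.finalState w).trace = 1
    rw [← trace_add, ← add_mul, M.proj_complete, one_mul, trace_finalState]
  rw [← rejTrace_eq_zero_iff]
  have h2 := M.rejTrace_nonneg (tape w) (Pi.single M.init 1)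
  constructor
  · intro h h3
    linarith
  · intro h
    have := lt_of_le_of_ne h2 (Ne.symm h)
    linarith

theorem universalRecognizes_empty_iff :
    M.UniversalRecognizes (∅ : Set (List (Fin M.numSymbols))) ↔
      ∀ w, ¬ NeverRejects M.ops M.projRej (tape w) (Pi.single M.init 1) := by
  simp only [← accProb_lt_one_iff]
  exact ⟨fun h w => h.2 w (Set.notMem_empty w), fun h =>
    ⟨fun w hw => absurd hw (Set.notMem_empty w), fun w _ => h w⟩⟩

section

variable {S ι : Type*} [Fintype ι] {ops : S → List (Matrix ι ι ℚ)} {R : Matrix ι ι ℚ} {ts : List S}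
  {ψ φ : ι → ℚ}

theorem neverRejects_smul {c : ℚ} (hc : c ≠ 0) :
    NeverRejects ops R ts (c • ψ) ↔ NeverRejects ops R ts ψ := by
  induction ts generalizing ψ with
  | nil => simp [NeverRejects, mulVec_smul, hc]
  | cons σ ts ih => simp [NeverRejects, mulVec_smul, ih]

theorem neverRejects_zero : NeverRejects ops R ts 0 := by
  induction ts with
  | nil => simp [NeverRejects]
  | cons σ ts ih => simp [NeverRejects, ih]

/-- Adding a vector that all operation elements only rescale, and that is never rejected, changes
nothing. -/
theorem neverRejects_add_smul {x : ℚ} (hφ : R *ᵥ φ = 0)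
    (h : ∀ σ, ∀ E ∈ ops σ, ∃ y : ℚ, E *ᵥ φ = y • φ) :
    NeverRejects ops R ts (ψ + x • φ) ↔ NeverRejects ops R ts ψ := by
  induction ts generalizing ψ x with
  | nil => simp [NeverRejects, mulVec_add, mulVec_smul, hφ]
  | cons σ ts ih =>
    refine forall₂_congr fun E hE => ?_
    obtain ⟨y, hy⟩ := h σ E hE
    rw [mulVec_add, mulVec_smul, hy, smul_smul, ih]

/-- Used for the rejecting basis vector: some choice of elements preserves it up to the measurement,
so a failed check is never forgotten. -/
theorem eq_zero_of_neverRejects_smul {x : ℚ} (hφ : R *ᵥ φ ≠ 0)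
    (h : ∀ σ, ∃ E ∈ ops σ, E *ᵥ φ = φ) (hx : NeverRejects ops R ts (x • φ)) : x = 0 := by
  induction ts with
  | nil => simpa [NeverRejects, mulVec_smul, hφ] using hx
  | cons σ ts ih =>
    obtain ⟨E, hE, hE'⟩ := h σ
    have := hx E hE
    rw [mulVec_smul, hE'] at this
    exact ih this

end

end QFA

/-! ### Completing a rational matrix to a superoperator. -/

section Gram

/-- The sums of matrices `u uᵀ`. -/
def gramCone (ι : Type*) : AddSubmonoid (Matrix ι ι ℚ) :=
  AddSubmonoid.closure (Set.range fun u : ι → ℚ => vecMulVec u u)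

theorem vecMulVec_mem_gramCone {ι : Type*} (u : ι → ℚ) : vecMulVec u u ∈ gramCone ι :=
  AddSubmonoid.subset_closure ⟨u, rfl⟩

variable {ι : Type*} [Fintype ι] [DecidableEq ι]

theorem transpose_mul_mul_mem_gramCone {B : Matrix ι ι ℚ} (hB : B ∈ gramCone ι)
    (C : Matrix ι ι ℚ) : Cᵀ * B * C ∈ gramCone ι := by
  induction hB using AddSubmonoid.closure_induction with
  | mem x h =>
    obtain ⟨u, rfl⟩ := h
    simp only [mul_vecMulVec, vecMulVec_mul, ← mulVec_transpose]
    exact vecMulVec_mem_gramCone _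
  | zero => simp
  | add x y _ _ hx hy =>
    rw [mul_add, add_mul]
    exact add_mem hx hy

/-- A nonnegative rational need not be a square, but it is `num * den` copies of the square of `1 /
den`. -/
theorem smul_mem_gramCone {B : Matrix ι ι ℚ} (hB : B ∈ gramCone ι) {q : ℚ} (hq : 0 ≤ q) :
    q • B ∈ gramCone ι := by
  have h : q • B = (q.num.toNat * q.den) •
      ((diagonal fun _ => (q.den : ℚ)⁻¹)ᵀ * B * diagonal fun _ => (q.den : ℚ)⁻¹) := by
    have h1 : ((q.num.toNat : ℕ) : ℚ) = q.num := by
      exact_mod_cast Int.toNat_of_nonneg (Rat.num_nonneg.2 hq)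
    have h2 : (q.den : ℚ) ≠ 0 := by exact_mod_cast q.den_nz
    have h3 : (q.num : ℚ) = q * q.den := (Rat.mul_den_eq_num q).symm
    ext i j
    simp only [← Nat.cast_smul_eq_nsmul ℚ, diagonal_transpose, Matrix.smul_apply, mul_diagonal,
      diagonal_mul, smul_eq_mul, Nat.cast_mul]
    rw [h1, h3]
    field_simp
  rw [h]
  exact nsmul_mem (transpose_mul_mul_mem_gramCone hB _) _

theorem transpose_mul_self_mem_gramCone {ι : Type*} [Fintype ι] (B : Matrix ι ι ℚ) : Bᵀ * B ∈ gramCone ι := by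
  have : Bᵀ * B = ∑ r, vecMulVec (B r) (B r) := by
    ext i j
    simp [mul_apply, Matrix.sum_apply, vecMulVec_apply]
  rw [this]
  exact sum_mem fun r _ => vecMulVec_mem_gramCone _

theorem one_mem_gramCone : (1 : Matrix ι ι ℚ) ∈ gramCone ι := by
  simpa using transpose_mul_self_mem_gramCone (1 : Matrix ι ι ℚ)

theorem exists_smul_one_sub_mem_gramCone (A : Matrix ι ι ℚ) :
    ∃ m : ℚ, 0 ≤ m ∧ m • 1 - Aᵀ * A ∈ gramCone ι := by
  induction A using Matrix.induction_on' with
  | h_zero => exact ⟨0, le_rfl, by simp⟩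
  | h_add X Y hX hY =>
    obtain ⟨m, hm, hX⟩ := hX
    obtain ⟨m', hm', hY⟩ := hY
    refine ⟨2 * m + 2 * m', by positivity, ?_⟩
    -- The parallelogram identity.
    have h : (2 * m + 2 * m') • 1 - (X + Y)ᵀ * (X + Y) =
        (2 : ℚ) • (m • 1 - Xᵀ * X) + (2 : ℚ) • (m' • 1 - Yᵀ * Y) + (X - Y)ᵀ * (X - Y) := by
      simp only [transpose_add, transpose_sub, add_mul, mul_add, sub_mul, mul_sub, add_smul,
        smul_sub, smul_smul, two_smul]
      abel
    rw [h]
    exact add_mem (add_mem (smul_mem_gramCone hX (by norm_num))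
      (smul_mem_gramCone hY (by norm_num))) (transpose_mul_self_mem_gramCone _)
  | h_std_basis i j a =>
    refine ⟨a * a, mul_self_nonneg a, ?_⟩
    have h : (a * a) • (1 : Matrix ι ι ℚ) - (single i j a)ᵀ * single i j a =
        (diagonal fun k => if k = j then 0 else a)ᵀ * diagonal fun k => if k = j then 0 else a := by
      rw [diagonal_transpose, diagonal_mul_diagonal, transpose_single, single_mul_single_same]
      ext k l
      simp only [Matrix.sub_apply, Matrix.smul_apply, one_apply, single_apply, diagonal_apply, smul_eq_mul]
      grind
    rw [h]
    exact transpose_mul_self_mem_gramCone _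

theorem exists_one_sub_smul_mem_gramCone (A : Matrix ι ι ℚ) :
    ∃ c : ℚ, c ≠ 0 ∧ 1 - (c • A)ᵀ * (c • A) ∈ gramCone ι := by
  obtain ⟨m, hm, h⟩ := exists_smul_one_sub_mem_gramCone A
  have h0 : m + 1 ≠ 0 := by positivity
  -- The bound `m` need not have a rational square root, but it is below the square `(m + 1)²`, with
  -- excess `m² + m + 1`.
  refine ⟨(m + 1)⁻¹, inv_ne_zero h0, ?_⟩
  have h' : 1 - ((m + 1)⁻¹ • A)ᵀ * ((m + 1)⁻¹ • A) =
      ((m + 1)⁻¹ * (m + 1)⁻¹) • ((m * m + m + 1) • 1 + (m • 1 - Aᵀ * A)) := by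
    rw [transpose_smul, smul_mul_smul_comm, ← add_sub_assoc, ← add_smul, smul_sub, smul_smul]
    congr 1
    rw [show (m + 1)⁻¹ * (m + 1)⁻¹ * (m * m + m + 1 + m) = 1 by field_simp; ring, one_smul]
  rw [h']
  exact smul_mem_gramCone (add_mem (smul_mem_gramCone one_mem_gramCone (by positivity)) h)
    (mul_self_nonneg _)

/-- A matrix that vanishes on the basis vectors of a set can be completed, up to a factor, to
operation elements of a superoperator: the other elements are the projection to `b` and elements
whose range is spanned by the basis vector of `a`. -/
theorem exists_complete_ops (A : Matrix ι ι ℚ) (a b : ι) (hb : ∀ i, A i b = 0) :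
    ∃ c : ℚ, c ≠ 0 ∧ ∃ l : List (ι → ℚ),
      (((c • A) :: single b b 1 :: l.map (vecMulVec (Pi.single a 1))).map fun E => Eᴴ * E).sum
        = 1 := by
  obtain ⟨c, hc, h⟩ := exists_one_sub_smul_mem_gramCone A
  -- With `P = 1 - single b b 1` and `A * P = A`, compression by `P` turns the defect into `P - (c •
  -- A)ᵀ * (c • A)`, leaving room for the projection to `b`. Each summand `u uᵀ` is `Eᴴ * E` for the
  -- element `E` that maps `u` direction to `a`.
  have hP := transpose_mul_mul_mem_gramCone h (1 - single b b 1)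
  obtain ⟨l, hl, hsum⟩ := AddSubmonoid.exists_list_of_mem_closure hP
  choose! g hg using hl
  refine ⟨c, hc, l.map g, ?_⟩
  have hAb : c • A * (1 - single b b 1) = c • A := by
    ext i j
    rw [mul_sub, mul_one, Matrix.sub_apply, mul_apply]
    simp only [Matrix.smul_apply, single_apply, smul_eq_mul, mul_ite, mul_one, mul_zero,
      sub_eq_self]
    refine Finset.sum_eq_zero fun k _ => ?_
    split_ifs with h
    · rw [← h.1, hb, mul_zero]
    · rfl
  have hPP : (1 - single b b 1)ᵀ * (1 - single b b 1) = (1 - single b b 1 : Matrix ι ι ℚ) := by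
    rw [transpose_sub, transpose_one, transpose_single, sub_mul, mul_sub, mul_sub,
      single_mul_single_same]
    simp
  have hl : (l.map g).map (vecMulVec (Pi.single a 1)) =
      l.map fun x => vecMulVec (Pi.single a 1) (g x) := by simp
  have hl' : (l.map fun x => (vecMulVec (Pi.single a (1 : ℚ)) (g x))ᴴ *
      vecMulVec (Pi.single a 1) (g x)).sum = l.sum := by
    congr 1
    conv_rhs => rw [← List.map_id l]
    refine List.map_congr_left fun x hx => ?_
    rw [conjTranspose_eq_transpose_of_trivial, transpose_vecMulVec, vecMulVec_mul_vecMulVec]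
    simpa using hg x hx
  have hsum' : l.sum = 1 - single b b 1 - (c • A)ᵀ * (c • A) := by
    have key : ∀ P X : Matrix ι ι ℚ, Pᵀ * P = P → X * P = X →
        Pᵀ * (1 - Xᵀ * X) * P = P - Xᵀ * X := by
      intro P X h1 h2
      rw [mul_sub, mul_one, sub_mul, h1, mul_assoc, mul_assoc, h2, ← mul_assoc, ← transpose_mul, h2]
    rw [hsum, key _ _ hPP hAb]
  rw [List.map_cons, List.map_cons, List.sum_cons, List.sum_cons, hl, List.map_map]
  change _ + (_ + (l.map fun x => (vecMulVec (Pi.single a (1 : ℚ)) (g x))ᴴ *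
      vecMulVec (Pi.single a 1) (g x)).sum) = 1
  rw [hl', hsum']
  simp only [conjTranspose_eq_transpose_of_trivial, transpose_single, single_mul_single_same,
    mul_one]
  abel

end Gram

/-! ### Instructions as linear maps. -/

namespace Instr

/-- The registers of the instruction are among the first `d` ones. -/
def Below (d : ℕ) : Instr → Prop
  | clear i => i < d
  | inc i => i < d
  | add i j => i < d ∧ j < d
  | eq i j => i < d ∧ j < d

theorem Below.mono {a : Instr} {d d' : ℕ} (h : a.Below d) (hd : d ≤ d') : a.Below d' := by
  cases a <;> simp only [Below] at h ⊢ <;> omega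

theorem exists_below (a : Instr) : ∃ d, a.Below d := by
  cases a with
  | clear i => exact ⟨i + 1, Nat.lt_succ_self i⟩
  | inc i => exact ⟨i + 1, Nat.lt_succ_self i⟩
  | add i j => exact ⟨i + j + 1, by simp only [Below]; omega⟩
  | eq i j => exact ⟨i + j + 1, by simp only [Below]; omega⟩

/-- The effect of an instruction as a linear function of the registers and a constant `c`. -/
def linNext : Instr → ℚ → (ℕ → ℚ) → ℕ → ℚ
  | clear j, _, v, i => if i = j then 0 else v i
  | inc j, c, v, i => if i = j then v i + c else v i
  | add j l, _, v, i => if i = j then v i + v l else v i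
  | eq _ _, _, v, i => v i

/-- The linear form that vanishes when the check of an instruction is passed. -/
def linCheck : Instr → (ℕ → ℚ) → ℚ
  | eq i j, v => v i - v j
  | _, _ => 0

theorem linNext_add (a : Instr) (c c' : ℚ) (v v' : ℕ → ℚ) (i : ℕ) :
    a.linNext (c + c') (v + v') i = a.linNext c v i + a.linNext c' v' i := by
  cases a <;> simp only [linNext, Pi.add_apply] <;> split_ifs <;> ring

theorem linNext_smul (a : Instr) (x c : ℚ) (v : ℕ → ℚ) (i : ℕ) :
    a.linNext (x * c) (x • v) i = x * a.linNext c v i := by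
  cases a <;> simp only [linNext, Pi.smul_apply, smul_eq_mul] <;> split_ifs <;> ring

theorem linCheck_add (a : Instr) (v v' : ℕ → ℚ) :
    a.linCheck (v + v') = a.linCheck v + a.linCheck v' := by
  cases a <;> simp only [linCheck, Pi.add_apply] <;> ring

theorem linCheck_smul (a : Instr) (x : ℚ) (v : ℕ → ℚ) :
    a.linCheck (x • v) = x * a.linCheck v := by
  cases a <;> simp only [linCheck, Pi.smul_apply, smul_eq_mul] <;> ring

theorem linNext_of_below {a : Instr} {d : ℕ} (ha : a.Below d) {v : ℕ → ℕ} {u : ℕ → ℚ}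
    (hu : ∀ i < d, u i = v i) {i : ℕ} (hi : i < d) : a.linNext 1 u i = a.next v i := by
  cases a <;> simp only [Below] at ha <;> simp only [linNext, next, Function.update_apply] <;>
    (try split_ifs with h) <;> (try subst h) <;> simp [hu, ha, hi]

theorem linCheck_of_below {a : Instr} {d : ℕ} (ha : a.Below d) {v : ℕ → ℕ} {u : ℕ → ℚ}
    (hu : ∀ i < d, u i = v i) : a.linCheck u = 0 ↔ a.Passes v := by
  cases a <;> simp only [Below] at ha <;> simp [linCheck, Passes]
  rw [hu _ ha.1, hu _ ha.2, sub_eq_zero, Nat.cast_inj]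

end Instr

/-! ### The simulating automaton. -/

/-- The basis states of the automaton for a program with control states `Q` and `d` registers. -/
inductive Cell (Q : Type) (d : ℕ)
  | start
  | acc
  | rej
  | ctrl (q : Q)
  | reg (i : Fin d)
  deriving DecidableEq, Fintype

namespace Cell

variable {Q : Type} {d N : ℕ} (e : Cell Q d ≃ Fin N)

/-- The register amplitudes of a vector. -/
def regs (ψ : Fin N → ℚ) (j : ℕ) : ℚ := if h : j < d then ψ (e (reg ⟨j, h⟩)) else 0

theorem regs_add (ψ φ : Fin N → ℚ) : regs e (ψ + φ) = regs e ψ + regs e φ := by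
  ext j
  by_cases h : j < d <;> simp [regs, h]

theorem regs_smul (x : ℚ) (ψ : Fin N → ℚ) : regs e (x • ψ) = x • regs e ψ := by
  ext j
  by_cases h : j < d <;> simp [regs, h]

variable [DecidableEq Q]

/-- The vector for the control state `q` and the registers `v`, with amplitude `r` for rejection. -/
def state (q : Q) (v : ℕ → ℕ) (r : ℚ) : Fin N → ℚ := fun t =>
  match e.symm t with
  | ctrl q' => if q' = q then 1 else 0
  | reg i => v i
  | rej => r
  | _ => 0

variable [Fintype Q]

/-- The linear map that updates the control state by `f` and the registers by `a`, and puts the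
linear form of the check of `a` into the amplitude for rejection. -/
def instrMap (f : Q → Q) (a : Instr) : (Fin N → ℚ) →ₗ[ℚ] (Fin N → ℚ) where
  toFun ψ t :=
    match e.symm t with
    | ctrl q' => ∑ q, if f q = q' then ψ (e (ctrl q)) else 0
    | reg i => a.linNext (∑ q, ψ (e (ctrl q))) (regs e ψ) i
    | rej => a.linCheck (regs e ψ)
    | _ => 0
  map_add' ψ φ := by
    ext t
    simp only [Pi.add_apply]
    cases e.symm t
    · simp
    · simp
    · simp [regs_add, Instr.linCheck_add]
    · simp [← Finset.sum_add_distrib, ← ite_add_zero]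
    · simp [Finset.sum_add_distrib, regs_add, Instr.linNext_add]
  map_smul' x ψ := by
    ext t
    simp only [Pi.smul_apply, smul_eq_mul, RingHom.id_apply]
    cases e.symm t
    · simp
    · simp
    · simp [regs_smul, Instr.linCheck_smul]
    · simp [Finset.mul_sum]
    · simp [← Finset.mul_sum, regs_smul, Instr.linNext_smul]

/-- The control amplitudes of a `state` sum to 1, which supplies the constant that `inc` adds. The
old amplitude `r` is discarded here; the separate projection to `rej` retains it. -/
theorem instrMap_state {f : Q → Q} {a : Instr} (ha : a.Below d) (q : Q) (v : ℕ → ℕ) (r : ℚ) :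
    ∃ r', (r' = 0 ↔ a.Passes v) ∧
      instrMap e f a (state e q v r) = state e (f q) (a.next v) r' := by
  have hu : ∀ i < d, regs e (state e q v r) i = v i := fun i hi => by simp [regs, state, hi]
  refine ⟨_, Instr.linCheck_of_below ha hu, ?_⟩
  ext t
  simp only [instrMap, LinearMap.coe_mk, AddHom.coe_mk, state]
  cases e.symm t with
  | start => rfl
  | acc => rfl
  | rej => rfl
  | ctrl q' =>
    simp only [Equiv.symm_apply_apply]
    rw [Finset.sum_eq_single q (fun b _ hb => by simp [hb]) (by simp)]
    simp [eq_comm]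
  | reg i =>
    simp only [Equiv.symm_apply_apply, Finset.sum_ite_eq', Finset.mem_univ, if_true]
    exact Instr.linNext_of_below ha hu i.2

/-- The matrix of `instrMap`. -/
def instrMatrix (f : Q → Q) (a : Instr) : Matrix (Fin N) (Fin N) ℚ :=
  LinearMap.toMatrix' (instrMap e f a)

theorem instrMatrix_mulVec (f : Q → Q) (a : Instr) (ψ : Fin N → ℚ) :
    instrMatrix e f a *ᵥ ψ = instrMap e f a ψ := by
  rw [instrMatrix, LinearMap.toMatrix'_mulVec]

theorem instrMap_single_eq_zero (f : Q → Q) (a : Instr) {c : Cell Q d} (hq : ∀ q, ctrl q ≠ c)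
    (hi : ∀ i, reg i ≠ c) (x : ℚ) : instrMap e f a (Pi.single (e c) x) = 0 := by
  have h0 : regs e (Pi.single (e c) x) = 0 := by
    ext j
    by_cases h : j < d <;> simp [regs, h, hi]
  ext t
  simp only [instrMap, LinearMap.coe_mk, AddHom.coe_mk, h0]
  cases e.symm t with
  | start => rfl
  | acc => rfl
  | rej => cases a <;> simp [Instr.linCheck]
  | ctrl q' => simp [hq]
  | reg i => cases a <;> simp [Instr.linNext, hq]

end Cell

namespace Cell

variable {Q : Type} {d N k : ℕ} (e : Cell Q (d + 2) ≃ Fin N)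

/-- The unit vector for the control state `q`, the registers `n, n, 0, 0, …`, and an accepting
component that makes the normalization factor rational. -/
def initVec (q : Q) (n : ℕ) : Fin N → ℚ :=
  ((n : ℚ) ^ 2 + 1)⁻¹ • (Pi.single (e (ctrl q)) 1 + Pi.single (e (reg 0)) (n : ℚ) +
    Pi.single (e (reg 1)) (n : ℚ) + Pi.single (e acc) ((n : ℚ) ^ 2))

/-- Doubling the register and adding `n ^ 2` completes a square: `1 + n² + n² + n⁴ = (n² + 1)²`. -/
theorem initVec_dotProduct_self (q : Q) (n : ℕ) : initVec e q n ⬝ᵥ initVec e q n = 1 := by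
  have h : (n : ℚ) ^ 2 + 1 ≠ 0 := by positivity
  simp only [initVec, smul_dotProduct, dotProduct_smul, add_dotProduct, single_dotProduct,
    Pi.add_apply, Pi.single_apply, e.injective.eq_iff, smul_eq_mul]
  simp
  field_simp
  ring

/-- The register contents `n, n, 0, 0, …`. -/
def initRegs (n : ℕ) : ℕ → ℕ := fun j => if j < 2 then n else 0

theorem initVec_eq [DecidableEq Q] (q : Q) (n : ℕ) :
    initVec e q n = ((n : ℚ) ^ 2 + 1)⁻¹ •
      (state e q (initRegs n) 0 + (n : ℚ) ^ 2 • Pi.single (e acc) 1) := by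
  rw [initVec]
  congr 1
  ext t
  obtain ⟨c, rfl⟩ := e.surjective t
  simp only [state, Pi.add_apply, Pi.smul_apply, Pi.single_apply, e.injective.eq_iff,
    Equiv.symm_apply_apply, smul_eq_mul]
  cases c with
  | start => simp
  | acc => simp
  | rej => simp
  | ctrl q' => simp
  | reg i =>
    refine Fin.cases ?_ (fun i => Fin.cases ?_ (fun i => ?_) i) i
    · simp [initRegs]
    · simp [initRegs]
    · have h0 : i.succ.succ ≠ 0 := Fin.succ_ne_zero _
      have h1 : i.succ.succ ≠ 1 := fun h => Fin.succ_ne_zero _ (Fin.succ_injective _ h)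
      simp [initRegs, h0, h1]

open Classical in
/-- The outcome of the final check of a basis state: `rej` for rejecting and for the control states
that do not accept, and `acc` otherwise. -/
noncomputable def outcome (S : Set Q) : Cell Q (d + 2) → Cell Q (d + 2)
  | rej => rej
  | ctrl q => if q ∈ S then acc else rej
  | _ => acc

/-- The operation elements of the end-marker that are used on its second occurrence. -/
noncomputable def finalOps (S : Set Q) : List (Matrix (Fin N) (Fin N) ℚ) :=
  (Finset.univ.erase (e start)).toList.map fun t => single (e (outcome S (e.symm t))) t 1

theorem sum_finalOps (S : Set Q) :
    ((finalOps e S).map fun E => Eᴴ * E).sum = 1 - single (e start) (e start) 1 := by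
  rw [finalOps, List.map_map]
  have h : ((fun E : Matrix (Fin N) (Fin N) ℚ => Eᴴ * E) ∘
      fun t => single (e (outcome S (e.symm t))) t 1) = fun t => single t t (1 : ℚ) := by
    ext1 t
    simp [conjTranspose_eq_transpose_of_trivial]
  rw [h, Finset.sum_map_toList, Finset.sum_erase_eq_sub (Finset.mem_univ _),
    sum_single_eq_diagonal, diagonal_one]

/-- The operation elements of the automaton for the initial registers `n, n, 0, …`; the lists `l` are
those of the instructions. -/
noncomputable def simOps (D : DFA (Fin k) Q) (l : Fin k → List (Matrix (Fin N) (Fin N) ℚ)) (n : ℕ) :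
    Option (Fin k) → List (Matrix (Fin N) (Fin N) ℚ)
  | none => vecMulVec (initVec e D.start n) (Pi.single (e start) 1) :: finalOps e D.accept
  | some a => l a

/-- The automaton that rejects with probability `0` exactly the words of instructions that belong
to the language of the control automaton `D` and can be executed from the registers `n, n, 0, …`;
the lists `l` are the operation elements of the instructions. -/
noncomputable def simulator (D : DFA (Fin k) Q) (l : Fin k → List (Matrix (Fin N) (Fin N) ℚ))
    (hl : ∀ a, ((l a).map fun E => Eᴴ * E).sum = 1) (n : ℕ) : QFA ℚ where
  numStates := N
  numSymbols := k
  ops := simOps e D l n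
  ops_complete := by
    rintro (_ | a)
    · rw [simOps, List.map_cons, List.sum_cons, sum_finalOps, conjTranspose_eq_transpose_of_trivial,
        transpose_vecMulVec, vecMulVec_mul_vecMulVec, initVec_dotProduct_self, one_smul,
        ← single_eq_single_vecMulVec_single, add_sub_cancel]
    · exact hl a
  init := e start
  projAcc := 1 - single (e rej) (e rej) 1
  projRej := single (e rej) (e rej) 1
  projAcc_herm := by simp [IsHermitian]
  projAcc_idem := by simp [sub_mul, mul_sub]
  projRej_herm := by simp [IsHermitian]
  projRej_idem := by simp
  proj_complete := by simp

variable [Fintype Q] [DecidableEq Q]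

/-- The lists consist of multiples of the instruction matrices, the projection to `rej`, and
elements whose range is spanned by the basis vector of `acc`. -/
def IsInstrOps (D : DFA (Fin k) Q) (ins : Fin k → Instr)
    (l : Fin k → List (Matrix (Fin N) (Fin N) ℚ)) : Prop :=
  ∀ a, ∃ c : ℚ, c ≠ 0 ∧ ∃ us : List (Fin N → ℚ),
    l a = (c • instrMatrix e (D.step · a) (ins a)) :: single (e rej) (e rej) 1 ::
      us.map (vecMulVec (Pi.single (e acc) 1))

theorem exists_isInstrOps (D : DFA (Fin k) Q) (ins : Fin k → Instr) :
    ∃ l : Fin k → List (Matrix (Fin N) (Fin N) ℚ),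
      (∀ a, ((l a).map fun E => Eᴴ * E).sum = 1) ∧ IsInstrOps e D ins l := by
  have h : ∀ a : Fin k, ∃ l : List (Matrix (Fin N) (Fin N) ℚ),
      (l.map fun E => Eᴴ * E).sum = 1 ∧ ∃ c : ℚ, c ≠ 0 ∧ ∃ us : List (Fin N → ℚ),
        l = (c • instrMatrix e (D.step · a) (ins a)) :: single (e rej) (e rej) 1 ::
          us.map (vecMulVec (Pi.single (e acc) 1)) := by
    intro a
    obtain ⟨c, hc, us, h⟩ := exists_complete_ops (instrMatrix e (D.step · a) (ins a)) (e acc) (e rej)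
      (fun i => by
        have := congrFun (instrMatrix_mulVec e (D.step · a) (ins a) (Pi.single (e rej) 1)) i
        rw [instrMap_single_eq_zero e _ _ (by simp) (by simp), mulVec_single_one] at this
        exact this)
    exact ⟨_, h, c, hc, us, rfl⟩
  choose l h1 h2 using h
  exact ⟨l, h1, h2⟩

variable {e}
variable {D : DFA (Fin k) Q} {ins : Fin k → Instr} {l : Fin k → List (Matrix (Fin N) (Fin N) ℚ)}
  (h : IsInstrOps e D ins l) {n : ℕ}

include h in
theorem simOps_mulVec_acc (σ) :
    ∀ E ∈ simOps e D l n σ, ∃ y : ℚ,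
      E *ᵥ Pi.single (e acc) 1 = y • Pi.single (e acc) (1 : ℚ) := by
  intro E hE
  rcases σ with _ | a
  · rcases List.mem_cons.1 hE with rfl | hE
    · refine ⟨0, ?_⟩
      rw [vecMulVec_mulVec, single_one_dotProduct]
      simp
    · obtain ⟨t, ht, rfl⟩ := List.mem_map.1 hE
      by_cases hta : t = e acc
      · subst hta
        exact ⟨1, by rw [single_mulVec_eq]; simp [outcome]⟩
      · exact ⟨0, by rw [single_mulVec_eq]; simp [hta]⟩
  · obtain ⟨c, hc, us, hla⟩ := h a
    have hE : E ∈ l a := hE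
    rw [hla] at hE
    rcases List.mem_cons.1 hE with rfl | hE
    · refine ⟨0, ?_⟩
      rw [smul_mulVec, instrMatrix_mulVec, instrMap_single_eq_zero e _ _ (by simp) (by simp)]
      simp
    rcases List.mem_cons.1 hE with rfl | hE
    · exact ⟨0, by rw [single_mulVec_eq]; simp⟩
    · obtain ⟨u, _, rfl⟩ := List.mem_map.1 hE
      exact ⟨_, by rw [vecMulVec_mulVec, op_smul_eq_smul]⟩

include h in
theorem exists_simOps_mulVec_rej (σ) :
    ∃ E ∈ simOps e D l n σ, E *ᵥ Pi.single (e rej) 1 = Pi.single (e rej) (1 : ℚ) := by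
  rcases σ with _ | a
  · refine ⟨_, List.mem_cons_of_mem _ (List.mem_map.2 ⟨e rej, by simp, rfl⟩), ?_⟩
    rw [single_mulVec_eq]
    simp [outcome]
  · obtain ⟨c, hc, us, hla⟩ := h a
    refine ⟨single (e rej) (e rej) 1, ?_, ?_⟩
    · change _ ∈ l a
      simp [hla]
    · rw [single_mulVec_eq]
      simp

include h in
theorem neverRejects_smul_acc (ts : List (Option (Fin k))) (x : ℚ) :
    QFA.NeverRejects (simOps e D l n) (single (e rej) (e rej) 1) ts (x • Pi.single (e acc) 1) := by
  have := (QFA.neverRejects_add_smul (ops := simOps e D l n) (R := single (e rej) (e rej) 1) (ts := ts) (ψ := 0) (x := x)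
    (φ := Pi.single (e acc) 1) (by rw [single_mulVec_eq]; simp)
    (simOps_mulVec_acc h)).2 QFA.neverRejects_zero
  rwa [zero_add] at this

include h in
theorem neverRejects_smul_rej (ts : List (Option (Fin k))) (x : ℚ) :
    QFA.NeverRejects (simOps e D l n) (single (e rej) (e rej) 1) ts (x • Pi.single (e rej) 1) ↔ x = 0 := by
  constructor
  · refine QFA.eq_zero_of_neverRejects_smul (ops := simOps e D l n) (R := single (e rej) (e rej) 1) ?_
      (exists_simOps_mulVec_rej h)
    rw [single_mulVec_eq]
    simp
  · rintro rfl
    rw [zero_smul]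
    exact QFA.neverRejects_zero

include h in
-- On an instruction, the multiple of its matrix carries out the simulation, the projection to `rej`
-- demands `r = 0`, and the remaining elements lead to multiples of `acc`, which are harmless. The
-- end-marker inspects the basis states separately, so it demands `r = 0` and an accepting control
-- state.
theorem neverRejects_iff (hins : ∀ a, (ins a).Below (d + 2)) (w : List (Fin k)) (q : Q)
    (v : ℕ → ℕ) (r : ℚ) :
    QFA.NeverRejects (simOps e D l n) (single (e rej) (e rej) 1) (w.map some ++ [none]) (state e q v r) ↔
      r = 0 ∧ (∃ v', Instr.Exec (w.map ins) v v') ∧ D.evalFrom q w ∈ D.accept := by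
  induction w generalizing q v r with
  | nil =>
    change (∀ E ∈ vecMulVec (initVec e D.start n) (Pi.single (e start) 1) :: finalOps e D.accept,
      single (e rej) (e rej) (1 : ℚ) *ᵥ (E *ᵥ state e q v r) = 0) ↔ _
    have hs : state e q v r (e start) = 0 := by simp [state]
    have hr : state e q v r (e rej) = r := by simp [state]
    have hq : ∀ q', state e q v r (e (ctrl q')) = if q' = q then 1 else 0 := by simp [state]
    simp only [List.forall_mem_cons, vecMulVec_mulVec,
      single_one_dotProduct, hs, finalOps, List.forall_mem_map, Finset.mem_toList,
      Finset.mem_erase, Finset.mem_univ, and_true, single_mulVec_eq]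
    have hex : ∃ v', Instr.Exec (List.map ins []) v v' := ⟨v, rfl⟩
    simp only [hex, true_and, DFA.evalFrom_nil]
    constructor
    · rintro ⟨-, hall⟩
      refine ⟨?_, ?_⟩
      · have := hall (e rej) (by simp)
        simpa [outcome, hr] using this
      · by_contra hacc
        have := hall (e (ctrl q)) (by simp)
        simp [outcome, hq, hacc] at this
    · rintro ⟨rfl, hacc⟩
      refine ⟨by simp, fun t ht => ?_⟩
      obtain ⟨c, rfl⟩ := e.surjective t
      cases c with
      | start => simp at ht
      | acc => simp [outcome]
      | rej => simp [hr]
      | reg i => simp [outcome]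
      | ctrl q' =>
        by_cases hqq : q' = q
        · subst hqq
          simp [outcome, hacc]
        · simp [hq, hqq]
  | cons a w ih =>
    obtain ⟨c, hc, us, hla⟩ := h a
    obtain ⟨r', hr', hmap⟩ := instrMap_state e (f := (D.step · a)) (hins a) q v r
    change (∀ E ∈ l a, QFA.NeverRejects (simOps e D l n) (single (e rej) (e rej) 1) (w.map some ++ [none])
      (E *ᵥ state e q v r)) ↔ _
    have hr : state e q v r (e rej) = r := by simp [state]
    rw [hla, List.forall_mem_cons, List.forall_mem_cons, smul_mulVec, QFA.neverRejects_smul hc,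
      instrMatrix_mulVec, hmap, ih, hr', single_mulVec_eq, one_mul, hr,
      neverRejects_smul_rej h]
    have hus : ∀ E ∈ us.map (vecMulVec (Pi.single (e acc) 1)),
        QFA.NeverRejects (simOps e D l n) (single (e rej) (e rej) 1) (w.map some ++ [none]) (E *ᵥ state e q v r) := by
      intro E hE
      obtain ⟨u, _, rfl⟩ := List.mem_map.1 hE
      rw [vecMulVec_mulVec, op_smul_eq_smul]
      exact neverRejects_smul_acc h _ _
    simp only [List.map_cons, Instr.Exec, DFA.evalFrom_cons, exists_and_left]
    tauto

include h in
theorem neverRejects_tape_iff (hins : ∀ a, (ins a).Below (d + 2)) (w : List (Fin k)) :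
    QFA.NeverRejects (simOps e D l n) (single (e rej) (e rej) 1) (QFA.tape w) (Pi.single (e start) 1) ↔
      (∃ v', Instr.Exec (w.map ins) (initRegs n) v') ∧ w ∈ D.accepts := by
  have h0 : ((n : ℚ) ^ 2 + 1)⁻¹ ≠ 0 := by positivity
  change (∀ E ∈ vecMulVec (initVec e D.start n) (Pi.single (e start) 1) :: finalOps e D.accept,
    QFA.NeverRejects (simOps e D l n) (single (e rej) (e rej) 1) (w.map some ++ [none]) (E *ᵥ Pi.single (e start) 1)) ↔ _
  have hfin : ∀ E ∈ finalOps e D.accept, QFA.NeverRejects (simOps e D l n) (single (e rej) (e rej) 1)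
      (w.map some ++ [none]) (E *ᵥ Pi.single (e start) 1) := by
    intro E hE
    obtain ⟨t, ht, rfl⟩ := List.mem_map.1 hE
    have ht : t ≠ e start := by simpa using ht
    -- The two occurrences of the end-marker do not interfere: at the first, only `start` is
    -- occupied, which the final elements annihilate; at the second, `start` is empty.
    rw [single_mulVec_eq, Pi.single_eq_of_ne ht, mul_zero, zero_smul]
    exact QFA.neverRejects_zero
  rw [List.forall_mem_cons, and_iff_left hfin, vecMulVec_mulVec, single_one_dotProduct,
    Pi.single_eq_same, MulOpposite.op_one, one_smul, initVec_eq, QFA.neverRejects_smul h0,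
    QFA.neverRejects_add_smul (ops := simOps e D l n) (R := single (e rej) (e rej) 1)
      (by rw [single_mulVec_eq]; simp) (simOps_mulVec_acc h),
    neverRejects_iff h hins, DFA.mem_accepts, DFA.eval]
  simp

end Cell

/-! ### Computability of the reduction. -/

theorem primrec_int_natCast : Primrec fun n : ℕ => (n : ℤ) := by
  have h : ∀ n : ℕ, Encodable.encode (n : ℤ) = 2 * n := fun n => rfl
  refine Primrec.encode_iff.1 ?_
  simp only [h]
  exact Primrec.nat_mul.comp (Primrec.const 2) Primrec.id

theorem computable_num_den_of_coprime {f g : ℕ → ℕ} (hf : Computable f) (hg : Computable g)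
    (hpos : ∀ n, 0 < g n) (h : ∀ n, (f n).Coprime (g n)) :
    Computable fun n => (((f n : ℚ) / g n).num, ((f n : ℚ) / g n).den) := by
  have h1 : ∀ n, ((f n : ℚ) / g n).num = f n := fun n =>
    Rat.num_div_eq_of_coprime (a := f n) (b := g n) (by exact_mod_cast hpos n) (by simpa using h n)
  have h2 : ∀ n, ((f n : ℚ) / g n).den = g n := fun n => by
    have := Rat.den_div_eq_of_coprime (a := f n) (b := g n) (by exact_mod_cast hpos n)
      (by simpa using h n)
    rw [Int.cast_natCast, Int.cast_natCast] at this
    exact Int.natCast_inj.1 this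
  simp only [h1, h2]
  exact (primrec_int_natCast.to_comp.comp hf).pair hg

theorem computable_encodeMatrix {N : ℕ} {A : ℕ → Matrix (Fin N) (Fin N) ℚ}
    (h : ∀ i j, Computable fun n => ((A n i j).num, (A n i j).den)) :
    Computable fun n => QFA.encodeMatrix (A n) :=
  Computable.list_ofFn fun i => Computable.list_ofFn fun j => h i j

namespace Cell

variable {Q : Type} {d N k : ℕ} (e : Cell Q (d + 2) ≃ Fin N)

/-- The nonzero entries have numerators 1, `n` or `n ^ 2`, all coprime to `n ^ 2 + 1`, so the
fractions are already reduced and no gcd has to be computed. -/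
theorem exists_initVec_apply (q : Q) (t : Fin N) :
    (∀ n, initVec e q n t = 0) ∨ ∃ f : ℕ → ℕ, Computable f ∧ (∀ n, (f n).Coprime (n ^ 2 + 1)) ∧
      ∀ n, initVec e q n t = (f n : ℚ) / (n ^ 2 + 1 : ℕ) := by
  classical
  have hsq : Computable fun n : ℕ => n ^ 2 := by
    simp only [sq]
    exact (Primrec.nat_mul.comp Primrec.id Primrec.id).to_comp
  have hc2 : ∀ n : ℕ, (n ^ 2).Coprime (n ^ 2 + 1) := by simp
  have hc1 : ∀ n : ℕ, n.Coprime (n ^ 2 + 1) := fun n =>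
    Nat.Coprime.coprime_dvd_left (Dvd.intro n (sq n).symm) (hc2 n)
  obtain ⟨c, rfl⟩ := e.surjective t
  have hv : ∀ n, initVec e q n (e c) = ((n : ℚ) ^ 2 + 1)⁻¹ * ((if c = ctrl q then 1 else 0) +
      (if c = reg 0 then (n : ℚ) else 0) + (if c = reg 1 then (n : ℚ) else 0) +
      if c = acc then (n : ℚ) ^ 2 else 0) := by
    intro n
    simp [initVec, Pi.single_apply, e.injective.eq_iff]
  simp only [hv]
  by_cases h1 : c = ctrl q
  · subst h1
    exact .inr ⟨fun _ => 1, Computable.const 1, by simp, fun n => by simp⟩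
  by_cases h2 : c = reg 0
  · subst h2
    exact .inr ⟨fun n => n, Computable.id, hc1, fun n => by simp; ring⟩
  by_cases h3 : c = reg 1
  · subst h3
    exact .inr ⟨fun n => n, Computable.id, hc1, fun n => by simp; ring⟩
  by_cases h4 : c = acc
  · subst h4
    exact .inr ⟨fun n => n ^ 2, hsq, hc2, fun n => by simp; ring⟩
  · exact .inl fun n => by simp [h1, h2, h3, h4]

/-- Only the operation element that prepares `initVec` varies with `n`. The rest is a constant, so
it does not matter that it was obtained by choice. -/
theorem computable_encode_simulator (D : DFA (Fin k) Q)
    (l : Fin k → List (Matrix (Fin N) (Fin N) ℚ))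
    (hl : ∀ a, ((l a).map fun E => Eᴴ * E).sum = 1) :
    Computable fun n => QFA.encode (simulator e D l hl n) := by
  have hsq : Computable fun n : ℕ => n ^ 2 + 1 := by
    simp only [sq]
    exact (Primrec.succ.comp (Primrec.nat_mul.comp Primrec.id Primrec.id)).to_comp
  have hinit : Computable fun n =>
      QFA.encodeMatrix (vecMulVec (initVec e D.start n) (Pi.single (e start) 1)) := by
    refine computable_encodeMatrix fun i j => ?_
    by_cases hj : j = e start
    · subst hj
      simp only [vecMulVec_apply, Pi.single_eq_same, mul_one]
      rcases exists_initVec_apply e D.start i with h | ⟨f, hf, hco, h⟩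
      · simp only [h]
        exact Computable.const _
      · simp only [h]
        exact computable_num_den_of_coprime hf hsq (fun n => Nat.succ_pos _) hco
    · simp only [vecMulVec_apply, Pi.single_eq_of_ne hj, mul_zero]
      exact Computable.const _
  have hcode : (fun n => QFA.encode (simulator e D l hl n)) = fun n => (N, k,
      (QFA.encodeMatrix (vecMulVec (initVec e D.start n) (Pi.single (e start) 1)) ::
        (finalOps e D.accept).map QFA.encodeMatrix) ::
          List.ofFn (fun a => (l a).map QFA.encodeMatrix), (e start : ℕ),
      QFA.encodeMatrix (1 - single (e rej) (e rej) 1),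
      QFA.encodeMatrix (single (e rej) (e rej) 1)) := rfl
  rw [hcode]
  exact (Computable.const N).pair ((Computable.const k).pair
    ((Computable.list_cons.comp (Computable.list_cons.comp hinit (Computable.const _))
      (Computable.const _)).pair (Computable.const _)))

end Cell

/-! ### Undecidability. -/

theorem exists_partrec_not_computablePred_dom :
    ∃ f : ℕ →. ℕ, Nat.Partrec f ∧ ¬ ComputablePred fun n => (f n).Dom := by
  refine ⟨fun n => (Denumerable.ofNat Nat.Partrec.Code n).eval 0, ?_, fun h => ?_⟩
  · refine Partrec.nat_iff.1 ?_
    exact Nat.Partrec.Code.eval_part.comp (Computable.ofNat _) (Computable.const 0)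
  · refine ComputablePred.halting_problem 0 ?_
    obtain ⟨p, hp, h⟩ := ComputablePred.computable_iff.1 h
    refine ComputablePred.computable_iff.2 ⟨fun c => p (Encodable.encode c),
      hp.comp Computable.encode, ?_⟩
    ext c
    simpa using congrFun h (Encodable.encode c)

/-- The emptiness problem for universal quantum finite automata with rational amplitudes is
undecidable. -/
theorem mainTheorem8 :
    ¬ DecidableProblem QFA.encode
      (fun M : QFA ℚ => M.UniversalRecognizes (∅ : Set (List (Fin M.numSymbols)))) := by
  rintro ⟨g, hg, hdec⟩
  obtain ⟨f, hf, hdom⟩ := exists_partrec_not_computablePred_dom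
  obtain ⟨L, ⟨hreg, S, hS⟩, hL⟩ := Instr.exists_program_dom hf
  obtain ⟨Q, hQ, D, hD⟩ := hreg
  classical
  obtain ⟨d, hd⟩ : ∃ d, ∀ a ∈ S, a.Below d := by
    choose b hb using Instr.exists_below
    exact ⟨S.sup b, fun a ha => (hb a).mono (Finset.le_sup ha)⟩
  -- The DFA reads the infinite alphabet `Instr`; it is pulled back to the finitely many
  -- instructions that occur in the program.
  let ins : Fin S.card → Instr := fun i => S.equivFin.symm i
  let e : Cell Q (d + 2) ≃ Fin (Fintype.card (Cell Q (d + 2))) := Fintype.equivFin _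
  obtain ⟨l, hl, hops⟩ := Cell.exists_isInstrOps e (D.comap ins) ins
  let M : ℕ → QFA ℚ := Cell.simulator e (D.comap ins) l hl
  have hins : ∀ a, (ins a).Below (d + 2) := fun a =>
    (hd _ (S.equivFin.symm a).2).mono (Nat.le_add_right d 2)
  have hM : ∀ n, (M n).UniversalRecognizes (∅ : Set (List (Fin (M n).numSymbols))) ↔
      ¬ (f n).Dom := by
    intro n
    rw [QFA.universalRecognizes_empty_iff, ← not_exists, not_iff_not]
    have h0 : Cell.initRegs n 0 = n := rfl
    have key := hL (Cell.initRegs n)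
    rw [h0] at key
    rw [key]
    constructor
    · rintro ⟨w, hw⟩
      obtain ⟨⟨v', h1⟩, h2⟩ := (Cell.neverRejects_tape_iff hops hins w).1 hw
      rw [DFA.accepts_comap, hD] at h2
      exact ⟨v', w.map ins, h2, h1⟩
    · rintro ⟨v', w, hw, h1⟩
      obtain ⟨w', rfl⟩ : ∃ w' : List (Fin S.card), w'.map ins = w := by
        refine Set.mem_range.1 ((Set.range_list_map ins).symm ▸ fun a ha => ?_)
        exact ⟨S.equivFin ⟨a, hS w hw a ha⟩, by simp [ins]⟩
      refine ⟨w', (Cell.neverRejects_tape_iff hops hins w').2 ⟨⟨v', h1⟩, ?_⟩⟩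
      rw [DFA.accepts_comap, hD]
      exact hw
  have hcode : Computable fun n => QFA.encode (M n) := Cell.computable_encode_simulator e _ l hl
  have hpart : Partrec fun n => g (QFA.encode (M n)) := hg.comp hcode
  -- The algorithm may diverge elsewhere, but it halts on every code of an `M n`, so the composite
  -- is total.
  choose b hb hbM using fun n => hdec (M n)
  have hcomp : Computable b := hpart.of_eq fun n => Part.eq_some_iff.2 (hb n)
  refine hdom (ComputablePred.computable_iff.2
    ⟨fun n => !b n, Primrec.not.to_comp.comp hcomp, ?_⟩)
  ext n
  have h := (hbM n).trans (hM n)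
  cases hbn : b n <;> simp_all
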